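/- **Theorem (Existence).** Work over $\mathbb C$ and let $N\ge 0$. Let $z$ be an even variable and $\theta^1,\dots,\theta^N$ odd anticommuting variables, $Z=(z,\theta^1,\dots,\theta^N)$, and similarly $W=(w,\zeta^1,\dots,\zeta^N)$. For $I=\{i_1<\dots<i_k\}\subset\{1,\dots,N\}$ put $\theta^I=\theta^{i_1}\cdots\theta^{i_k}$ and $Z^{n|I}=z^n\theta^I$; define $\sigma(I,J)\in\{0,\pm1\}$ by $\theta^I\theta^J=\sigma(I,J)\theta^{I\cup J}$ ($\sigma(I,J)=0$ if $I\cap J\ne\emptyset$) and $\sigma(J)=\sigma(J,N\setminus J)$, where $N\setminus J$ is the complement of $J$ in $\{1,\dots,N\}$. All sign rules are the super ones. For a vector superspace $V$, an $\mathrm{End}(V)$-valued *superfield* is a formal series $a(Z)=\sum_{j\in\mathbb Z,\,J}Z^{-1-j|N\setminus J}a_{(j|J)}$ with $a_{(j|J)}\in\mathrm{End}(V)$ such that for every $v\in V$ the series $a(Z)v$ contains only finitely many negative powers of $z$; it is homogeneous of parity $p$ if the coefficient of each $Z^{n|I}$ has parity $p+|I|$. Homogeneous $a(Z),b(Z)$,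 of parities again denoted $a,b$, are *local* if $(z-w)^n[a(Z),b(W)]=0$ for some $n\ge0$, where $[a(Z),b(W)]=a(Z)b(W)-(-1)^{ab}b(W)a(Z)$. For $j\in\mathbb Z$ and $J\subset\{1,\dots,N\}$ their $(j|J)$-product is $$a(W)_{(j|J)}b(W)=\mathrm{res}_Z\Big(i_{z,w}(Z-W)^{j|J}\,a(Z)b(W)-(-1)^{ab}\,i_{w,z}(Z-W)^{j|J}\,b(W)a(Z)\Big),$$ where $(Z-W)^{j|J}=(z-w)^j\prod_{i\in J}(\theta^i-\zeta^i)$ (factors in increasing order of $i$), $i_{z,w}$ and $i_{w,z}$ denote expansion in non-negative powers of $w$ and of $z$ respectively, and $\mathrm{res}_Z$ takes the coefficient of $Z^{-1|N}=z^{-1}\theta^1\cdots\theta^N$ (with $Z^{-1|N}$ written on the left). An *$N_W=N$ SUSY vertex algebra* is a vector superspace $V$ with an even vector $|0\rangle$, an even operator $T$, odd operators $S^1,\dots,S^N$ and a parity preserving linear map $a\mapsto Y(a,Z)$ from $V$ to $\mathrm{End}(V)$-valued superfields such that: $Y(a,Z)|0\rangle\in V[[Z]]$ with value $a$ at $Z=0$,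 and $T|0\rangle=S^i|0\rangle=0$; $[T,Y(a,Z)]=\partial_zY(a,Z)$ and $[S^i,Y(a,Z)]=\partial_{\theta^i}Y(a,Z)$; and all pairs $Y(a,Z),Y(b,Z)$ ($a$, $b$ homogeneous) are local. Let $V$ be a vector superspace, $|0\rangle\in V$ an even vector, $T$ an even endomorphism of $V$ and $S^1,\dots,S^N$ odd endomorphisms of $V$ that commute with $T$ and satisfy $S^iS^j=-S^jS^i$ for $i\neq j$, with $T|0\rangle=S^i|0\rangle=0$. Let $\{a^\alpha(Z)\}_{\alpha\in A}$ be a family of homogeneous $\mathrm{End}(V)$-valued superfields such that 1. $a^\alpha(Z)|0\rangle\in V[[Z]]$, with value $a^\alpha(Z)|0\rangle|_{Z=0}=a^\alpha\in V$; 2. $[T,a^\alpha(Z)]=\partial_za^\alpha(Z)$ and $[S^i,a^\alpha(Z)]=\partial_{\theta^i}a^\alpha(Z)$ for $i=1,\dots,N$; 3. all pairs $(a^\alpha(Z),a^\beta(Z))$ are local, including $\alpha=\beta$; 4. the vectors $a^{\alpha_s}_{(j_s|J_s)}\cdots a^{\alpha_1}_{(j_1|J_1)}|0\rangle$, $s\ge0$,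 span $V$. Then the formula $$Y\big(a^{\alpha_s}_{(j_s|J_s)}\cdots a^{\alpha_1}_{(j_1|J_1)}|0\rangle,Z\big)=\prod_{i=1}^s\sigma(J_i)\;a^{\alpha_s}(Z)_{(j_s|J_s)}\Big(\cdots a^{\alpha_2}(Z)_{(j_2|J_2)}\big(a^{\alpha_1}(Z)_{(j_1|J_1)}\mathrm{Id}\big)\cdots\Big)$$ gives a well defined structure of an $N_W=N$ SUSY vertex algebra on $V$ with vacuum vector $|0\rangle$ and translation operators $T,S^i$, such that $Y(a^\alpha,Z)=a^\alpha(Z)$ for all $\alpha\in A$. Moreover, an $N_W=N$ SUSY vertex algebra structure on $V$ with this vacuum vector, these translation operators, and $Y(a^\alpha,Z)=a^\alpha(Z)$ for all $\alpha\in A$ is unique. -/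

import Mathlib

namespace SUSY

/-! ### Signs

Odd coordinates `θ¹, …, θᴺ` are indexed by `Fin N`; an ordered tuple `I` is a `Finset (Fin N)`, and
`θ^I` is the product of the `θ^i`, `i ∈ I`, in increasing order. Parities live in `ZMod 2`. -/

/-- The sign `(-1)^p` of a parity `p`. -/
noncomputable def psign (p : ZMod 2) : ℂ := (-1) ^ p.val

/-- The sign `σ(I, J)` with `θ^I θ^J = σ(I, J) θ^(I ∪ J)`; it is `0` when `I` and `J` meet. -/
noncomputable def sigma {N : ℕ} (I J : Finset (Fin N)) : ℂ :=
  if Disjoint I J then (-1) ^ ((I ×ˢ J).filter fun x => x.2 < x.1).card else 0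

/-! ### Formal distributions -/

/-- `U`-valued formal distributions in `Z = (z, θ¹, …, θᴺ)`: the value of `a` at `n, I` is the
coefficient `a_{n|I}` in `a(Z) = ∑ Z^{n|I} a_{n|I}`, where `Z^{n|I} = z^n θ^I`. -/
abbrev Dist (N : ℕ) (U : Type*) := ℤ → Finset (Fin N) → U

/-- `U`-valued formal distributions in `Z = (z, θ)` and `W = (w, ζ)`: the value of `u` at
`n, I, m, K` is the coefficient in `u(Z, W) = ∑ Z^{n|I} W^{m|K} u_{n|I, m|K}`. -/
abbrev Dist₂ (N : ℕ) (U : Type*) := ℤ → Finset (Fin N) → ℤ → Finset (Fin N) → U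

/-- The derivative `∂_z a(Z)`. -/
def dz {N : ℕ} {U : Type*} [AddCommGroup U] (a : Dist N U) : Dist N U :=
  fun n I => (n + 1) • a (n + 1) I

/-- The derivative `∂_{θ^i} a(Z)`; recall that `σ(i, I) = 0` if `i ∈ I`. -/
noncomputable def dtheta {N : ℕ} {U : Type*} [AddCommGroup U] [Module ℂ U] (i : Fin N)
    (a : Dist N U) : Dist N U :=
  fun n I => sigma {i} I • a n (insert i I)

/-- Multiplication of a distribution in two variables by `z - w`. -/
def mulZsubW {N : ℕ} {U : Type*} [AddCommGroup U] (u : Dist₂ N U) : Dist₂ N U :=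
  fun n I m K => u (n - 1) I m K - u n I (m - 1) K

/-- The odd factor of the coefficients of `(Z - W)^{j|J}`, that is, the coefficient of `θ^K ζ^L` in
`∏_{i ∈ J} (θ^i - ζ^i)`. -/
noncomputable def oddCoeff {N : ℕ} (J K L : Finset (Fin N)) : ℂ :=
  if K ∪ L = J then (-1) ^ L.card * sigma K L else 0

/-- The expansion `i_{z,w} (Z - W)^{j|J}`, in non-negative powers of `w`, for
`(Z - W)^{j|J} = (z - w)^j ∏_{i ∈ J} (θ^i - ζ^i)`. -/
noncomputable def expZW {N : ℕ} (j : ℤ) (J : Finset (Fin N)) : Dist₂ N ℂ :=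
  fun k K l L =>
    if 0 ≤ l ∧ k + l = j then (-1) ^ l * ((Ring.choose j l.toNat : ℤ) : ℂ) * oddCoeff J K L else 0

/-- The expansion `i_{w,z} (Z - W)^{j|J}`, in non-negative powers of `z`. -/
noncomputable def expWZ {N : ℕ} (j : ℤ) (J : Finset (Fin N)) : Dist₂ N ℂ :=
  fun k K l L =>
    if 0 ≤ k ∧ k + l = j then (-1) ^ l * ((Ring.choose j k.toNat : ℤ) : ℂ) * oddCoeff J K L else 0

section Operators

variable {N : ℕ} {V : Type*} [AddCommGroup V] [Module ℂ V]

/-- The product `a(Z) b(W)`, where `a` has parity `p`: the coefficient `a_{n|I}`, of parity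
`p + |I|`, is moved past `ζ^K`. -/
noncomputable def mulZW (p : ZMod 2) (a b : Dist N (Module.End ℂ V)) :
    Dist₂ N (Module.End ℂ V) :=
  fun n I m K => psign ((p + I.card) * K.card) • (a n I * b m K)

/-- The product `b(W) a(Z)`, where `b` has parity `q`, written in the form
`∑ Z^{n|I} W^{m|K} u_{n|I, m|K}`: moving `θ^I` to the far left past `ζ^K b_{m|K}`, which has
parity `q`, gives the sign. -/
noncomputable def mulWZ (q : ZMod 2) (a b : Dist N (Module.End ℂ V)) :
    Dist₂ N (Module.End ℂ V) :=
  fun n I m K => psign (I.card * q) • (b m K * a n I)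

/-- The supercommutator `[a(Z), b(W)] = a(Z) b(W) - (-1)^{pq} b(W) a(Z)`, for `a` of parity `p`
and `b` of parity `q`. -/
noncomputable def superBracket (p q : ZMod 2) (a b : Dist N (Module.End ℂ V)) :
    Dist₂ N (Module.End ℂ V) :=
  mulZW p a b - psign (p * q) • mulWZ q a b

/-- Locality of a pair of distributions of parities `p` and `q`: `(z - w)^n [a(Z), b(W)] = 0` for
some `n`. -/
def IsLocal (p q : ZMod 2) (a b : Dist N (Module.End ℂ V)) : Prop :=
  ∃ n : ℕ, mulZsubW^[n] (superBracket p q a b) = 0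

/-- The supercommutator `[X, a(Z)] = X a(Z) - (-1)^{qp} a(Z) X` of an operator `X` of parity `q`
with a distribution of parity `p`; the sign `(-1)^{q|I|}` comes from moving `X` past `θ^I`. -/
noncomputable def opBracket (q p : ZMod 2) (X : Module.End ℂ V) (a : Dist N (Module.End ℂ V)) :
    Dist N (Module.End ℂ V) :=
  fun n I => psign (q * I.card) • (X * a n I) - psign (q * p) • (a n I * X)

/-! ### Superfields -/

variable (N V) in
/-- The space of `End(V)`-valued fields: those `a(Z)` for which `a(Z) v` has, for every `v`, only
finitely many negative powers of `z`. -/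
def superFields : Submodule ℂ (Dist N (Module.End ℂ V)) where
  carrier := {a | ∀ v, ∃ n₀ : ℤ, ∀ n < n₀, ∀ I, a n I v = 0}
  add_mem' := by
    intro a b ha hb v
    obtain ⟨n₁, h₁⟩ := ha v
    obtain ⟨n₂, h₂⟩ := hb v
    refine ⟨min n₁ n₂, fun n hn I => ?_⟩
    simp [h₁ n (lt_of_lt_of_le hn (min_le_left _ _)) I,
      h₂ n (lt_of_lt_of_le hn (min_le_right _ _)) I]
  zero_mem' := fun _ => ⟨0, fun _ _ _ => rfl⟩
  smul_mem' := by
    intro c a ha v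
    obtain ⟨n₁, h₁⟩ := ha v
    exact ⟨n₁, fun n hn I => by simp [h₁ n hn I]⟩

variable (N V) in
/-- `End(V)`-valued superfields. -/
abbrev SuperField := superFields N V

/-- A distribution `a(Z)` is homogeneous of parity `p`: the operator `a_{n|I}` has parity
`p + |I|`. -/
def HasParity (𝒱 : ZMod 2 → Submodule ℂ V) (p : ZMod 2) (a : Dist N (Module.End ℂ V)) : Prop :=
  ∀ n I q, ∀ v ∈ 𝒱 q, a n I v ∈ 𝒱 (p + I.card + q)

/-- The operators `a_{(j|J)}` in `a(Z) = ∑ Z^{-1-j|N∖J} a_{(j|J)}`. -/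
def mode (a : Dist N (Module.End ℂ V)) (j : ℤ) (J : Finset (Fin N)) : Module.End ℂ V :=
  a (-1 - j) Jᶜ

variable (N V) in
/-- The constant field `Id`. -/
def idField : SuperField N V :=
  ⟨fun n I => if n = 0 ∧ I = ∅ then 1 else 0, fun _ => ⟨0, fun n hn I => by
    have h : ¬(n = 0 ∧ I = ∅) := fun h => by omega
    simp [h]⟩⟩

/-! ### Products of superfields -/

/-- The coefficient of `W^{m|M}` in `res_Z (F(Z, W) u(Z, W)) v`, where `F` is a scalar distribution
and `res_Z` takes the coefficient of `Z^{-1|N}`. Since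
`Z^{k|K} W^{l|L} Z^{n|I} W^{m'|M'}
  = (-1)^{|L||I|} σ(K, I) σ(L, M') Z^{k+n|K ∪ I} W^{l+m'|L ∪ M'}`,
only `I = N∖K`, `n = -1 - k`, `M' = M∖L`, `m' = m - l` contribute. -/
noncomputable def resMul (F : Dist₂ N ℂ) (u : Dist₂ N (Module.End ℂ V)) (m : ℤ)
    (M : Finset (Fin N)) (v : V) : V :=
  ∑ᶠ kl : ℤ × ℤ, ∑ K : Finset (Fin N), ∑ L ∈ M.powerset,
    (psign (L.card * Kᶜ.card) * sigma K Kᶜ * sigma L (M \ L) * F kl.1 K kl.2 L) •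
      u (-1 - kl.1) Kᶜ (m - kl.2) (M \ L) v

theorem finite_support_ZW (p : ZMod 2) (a b : SuperField N V) (j : ℤ) (J : Finset (Fin N)) (m : ℤ)
    (M : Finset (Fin N)) (v : V) :
    (Function.support fun kl : ℤ × ℤ => ∑ K : Finset (Fin N), ∑ L ∈ M.powerset,
      (psign (L.card * Kᶜ.card) * sigma K Kᶜ * sigma L (M \ L) * expZW j J kl.1 K kl.2 L) •
        mulZW p a.1 b.1 (-1 - kl.1) Kᶜ (m - kl.2) (M \ L) v).Finite := by
  obtain ⟨n₀, h₀⟩ := b.2 v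
  refine ((Set.finite_Icc 0 (m - n₀)).image fun l => (j - l, l)).subset ?_
  rintro ⟨k, l⟩ hkl
  by_contra hcon
  refine hkl (Finset.sum_eq_zero fun K _ => Finset.sum_eq_zero fun L _ => ?_)
  by_cases hF : 0 ≤ l ∧ k + l = j
  · have hl : m - l < n₀ := by
      by_contra hl
      exact hcon ⟨l, ⟨hF.1, by omega⟩, by ext <;> simp; omega⟩
    simp [mulZW, h₀ _ hl]
  · simp [expZW, hF]

theorem finite_support_WZ (q : ZMod 2) (a b : SuperField N V) (j : ℤ) (J : Finset (Fin N)) (m : ℤ)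
    (M : Finset (Fin N)) (v : V) :
    (Function.support fun kl : ℤ × ℤ => ∑ K : Finset (Fin N), ∑ L ∈ M.powerset,
      (psign (L.card * Kᶜ.card) * sigma K Kᶜ * sigma L (M \ L) * expWZ j J kl.1 K kl.2 L) •
        mulWZ q a.1 b.1 (-1 - kl.1) Kᶜ (m - kl.2) (M \ L) v).Finite := by
  obtain ⟨n₀, h₀⟩ := a.2 v
  refine ((Set.finite_Icc 0 (-1 - n₀)).image fun k => (k, j - k)).subset ?_
  rintro ⟨k, l⟩ hkl
  by_contra hcon
  refine hkl (Finset.sum_eq_zero fun K _ => Finset.sum_eq_zero fun L _ => ?_)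
  by_cases hF : 0 ≤ k ∧ k + l = j
  · have hk : -1 - k < n₀ := by
      by_contra hk
      exact hcon ⟨k, ⟨hF.1, by omega⟩, by ext <;> simp; omega⟩
    simp [mulWZ, h₀ _ hk]
  · simp [expWZ, hF]

/-- The coefficient of `W^{m|M}` in
`res_Z (i_{z,w}(Z-W)^{j|J} a(Z) b(W) - (-1)^{pq} i_{w,z}(Z-W)^{j|J} b(W) a(Z))`. -/
noncomputable def prodCoeff (p q : ZMod 2) (a b : SuperField N V) (j : ℤ) (J : Finset (Fin N))
    (m : ℤ) (M : Finset (Fin N)) : Module.End ℂ V where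
  toFun v := resMul (expZW j J) (mulZW p a.1 b.1) m M v -
    psign (p * q) • resMul (expWZ j J) (mulWZ q a.1 b.1) m M v
  map_add' x y := by
    have h₁ : resMul (expZW j J) (mulZW p a.1 b.1) m M (x + y) =
        resMul (expZW j J) (mulZW p a.1 b.1) m M x +
          resMul (expZW j J) (mulZW p a.1 b.1) m M y := by
      unfold resMul
      rw [← finsum_add_distrib (finite_support_ZW p a b j J m M x)
        (finite_support_ZW p a b j J m M y)]
      simp only [map_add, smul_add, Finset.sum_add_distrib]
    have h₂ : resMul (expWZ j J) (mulWZ q a.1 b.1) m M (x + y) =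
        resMul (expWZ j J) (mulWZ q a.1 b.1) m M x +
          resMul (expWZ j J) (mulWZ q a.1 b.1) m M y := by
      unfold resMul
      rw [← finsum_add_distrib (finite_support_WZ q a b j J m M x)
        (finite_support_WZ q a b j J m M y)]
      simp only [map_add, smul_add, Finset.sum_add_distrib]
    rw [h₁, h₂, smul_add]
    abel
  map_smul' c x := by
    have h : ∀ (F : Dist₂ N ℂ) (u : Dist₂ N (Module.End ℂ V)),
        resMul F u m M (c • x) = c • resMul F u m M x := by
      intro F u
      unfold resMul
      rw [smul_finsum]
      simp only [map_smul, Finset.smul_sum, smul_comm c]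
    simp only [h, RingHom.id_apply, smul_sub, smul_comm c]

/-- The `(j|J)`-product, for all `j ∈ ℤ`, of a superfield `a` of parity `p` and a superfield `b` of
parity `q`:
`a(W)_{(j|J)} b(W) =
  res_Z (i_{z,w}(Z-W)^{j|J} a(Z) b(W) - (-1)^{pq} i_{w,z}(Z-W)^{j|J} b(W) a(Z))`.
It has parity `p + q + N - |J|`. -/
noncomputable def prod (p q : ZMod 2) (a b : SuperField N V) (j : ℤ) (J : Finset (Fin N)) :
    SuperField N V :=
  ⟨prodCoeff p q a b j J, by
    intro v
    obtain ⟨nb, hb⟩ := b.2 v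
    obtain ⟨na, ha⟩ := a.2 v
    have hex : ∀ (k : ℤ) (K : Finset (Fin N)), ∃ n₁ : ℤ, ∀ n < n₁, ∀ I,
        b.1 n I (a.1 k K v) = 0 := fun k K => b.2 _
    choose n₁ hn₁ using hex
    have hfin : ((Set.Icc (0 : ℤ) (-1 - na)) ×ˢ (Set.univ : Set (Finset (Fin N)))).Finite :=
      (Set.finite_Icc _ _).prod Set.finite_univ
    obtain ⟨B, hB⟩ := (hfin.image fun x => n₁ (-1 - x.1) x.2ᶜ + j - x.1).bddBelow
    refine ⟨min nb B, fun m hm M => ?_⟩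
    have h₁ : resMul (expZW j J) (mulZW p a.1 b.1) m M v = 0 := by
      unfold resMul
      refine finsum_eq_zero_of_forall_eq_zero fun kl =>
        Finset.sum_eq_zero fun K _ => Finset.sum_eq_zero fun L _ => ?_
      by_cases hF : 0 ≤ kl.2 ∧ kl.1 + kl.2 = j
      · have : m - kl.2 < nb := by
          have := lt_of_lt_of_le hm (min_le_left _ _)
          omega
        simp [mulZW, hb _ this]
      · simp [expZW, hF]
    have h₂ : resMul (expWZ j J) (mulWZ q a.1 b.1) m M v = 0 := by
      unfold resMul
      refine finsum_eq_zero_of_forall_eq_zero fun kl =>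
        Finset.sum_eq_zero fun K _ => Finset.sum_eq_zero fun L _ => ?_
      by_cases hF : 0 ≤ kl.1 ∧ kl.1 + kl.2 = j
      · by_cases hk : -1 - kl.1 < na
        · simp [mulWZ, ha _ hk]
        · have hle := hB ⟨(kl.1, K), ⟨⟨hF.1, by omega⟩, trivial⟩, rfl⟩
          have hm' := lt_of_lt_of_le hm (min_le_right _ _)
          have : m - kl.2 < n₁ (-1 - kl.1) Kᶜ := by
            simp only at hle
            omega
          simp [mulWZ, hn₁ _ _ _ this]
      · simp [expWZ, hF]
    simp [prodCoeff, h₁, h₂]⟩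

end Operators

/-! ### SUSY vertex algebras -/

/-- An `N_W = N` SUSY vertex algebra structure on the vector superspace `V = 𝒱 0 ⊕ 𝒱 1`. -/
@[ext]
structure SUSYVertexAlgebra (N : ℕ) {V : Type*} [AddCommGroup V] [Module ℂ V]
    (𝒱 : ZMod 2 → Submodule ℂ V) [DirectSum.Decomposition 𝒱] where
  /-- the vacuum vector -/
  vac : V
  /-- the even translation operator -/
  T : Module.End ℂ V
  /-- the odd translation operators -/
  S : Fin N → Module.End ℂ V
  /-- the state-field correspondence -/
  Y : V →ₗ[ℂ] SuperField N V
  vac_even : vac ∈ 𝒱 0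
  T_even : ∀ p, ∀ v ∈ 𝒱 p, T v ∈ 𝒱 p
  S_odd : ∀ i p, ∀ v ∈ 𝒱 p, S i v ∈ 𝒱 (p + 1)
  Y_parity : ∀ p, ∀ a ∈ 𝒱 p, HasParity 𝒱 p (Y a).1
  Y_vac_regular : ∀ a, ∀ n < 0, ∀ I, (Y a).1 n I vac = 0
  Y_vac_const : ∀ a, (Y a).1 0 ∅ vac = a
  T_vac : T vac = 0
  S_vac : ∀ i, S i vac = 0
  T_bracket : ∀ p, ∀ a ∈ 𝒱 p, opBracket 0 p T (Y a).1 = dz (Y a).1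
  S_bracket : ∀ i p, ∀ a ∈ 𝒱 p, opBracket 1 p (S i) (Y a).1 = dtheta i (Y a).1
  locality : ∀ p q, ∀ a ∈ 𝒱 p, ∀ b ∈ 𝒱 q, IsLocal p q (Y a).1 (Y b).1

/-! ### Words in the modes of a family of superfields

A word `[(α_s, j_s, J_s), …, (α_1, j_1, J_1)]` is a list of triples; `par α` is the parity of the
superfield `a α`. -/

section Words

variable {N : ℕ} {V : Type*} [AddCommGroup V] [Module ℂ V] {A : Type*}

/-- The vector `a^{α_s}_{(j_s|J_s)} ⋯ a^{α_1}_{(j_1|J_1)} |0⟩`. -/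
def wordVec (a : A → SuperField N V) (vac : V) : List (A × ℤ × Finset (Fin N)) → V
  | [] => vac
  | (α, j, J) :: w => mode (a α).1 j J (wordVec a vac w)

/-- The parity of the iterated product attached to a word. -/
def wordPar (par : A → ZMod 2) : List (A × ℤ × Finset (Fin N)) → ZMod 2
  | [] => 0
  | (α, _, J) :: w => par α + N - J.card + wordPar par w

/-- The iterated product
`a^{α_s}(Z)_{(j_s|J_s)} (⋯ a^{α_2}(Z)_{(j_2|J_2)} (a^{α_1}(Z)_{(j_1|J_1)} Id) ⋯)`. -/
noncomputable def wordField (par : A → ZMod 2) (a : A → SuperField N V) :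
    List (A × ℤ × Finset (Fin N)) → SuperField N V
  | [] => idField N V
  | (α, j, J) :: w => prod (par α) (wordPar par w) (a α) (wordField par a w) j J

/-- The sign `∏ σ(J_i)`, where `σ(J) = σ(J, N∖J)`. -/
noncomputable def wordSign (w : List (A × ℤ × Finset (Fin N))) : ℂ :=
  (w.map fun x => sigma x.2.2 x.2.2ᶜ).prod

end Words

end SUSY

/-! Two facts carry the theorem. The first is Dong's lemma (`EpsLocal.fieldProd`): if three fields
are pairwise local, a product of two of them is local to the third. Products also inherit parity,
covariance under `T` and `S i`, and regularity on the vacuum. Hence every iterated product of the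
generators is a covariant field local to the generators, and its value on the vacuum at `Z = 0` is,
up to the sign `wordSign`, the corresponding word vector (`wordField_vac`).

The second is Goddard uniqueness (`IsStateField.eq_zero`): a covariant homogeneous field that is
local to the generators and has zero state is zero. Covariance kills it on the vacuum, and locality
carries the vanishing through each mode of a generator, hence to all of `V`. So taking the state is
a bijection from even plus odd combinations of iterated products onto `V`, and `Y` is its inverse.
The product formula, `Y(a^α, Z) = a^α(Z)` and the uniqueness of the structure are further instances
of Goddard uniqueness.

One observation replaces manipulation of binomial series. Multiplication by `z - w` is injective on
distributions bounded below in `w`, so `i_{z,w}(z-w)^j u` is the only bounded family in `j` that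
starts at `u` and is shifted by `z - w` (`expand_unique`). Whatever commutes with `z - w` and
preserves boundedness therefore commutes with the expansions. The same injectivity drives Goddard
uniqueness.

The odd variables are finite bookkeeping: `prod_apply` writes each component of a `(j|J)`-product as
a signed sum of ordinary `j`-th products of components. The delicate use of these signs is the
Leibniz rule for `∂_{θ^i}` (`sum_prodSign_leibniz`). -/

namespace SUSY

/-! ### Expansions of `(z - w)^j` acting on distributions in two even variables -/

section Expansion

/-- Only finitely many negative powers of the second variable occur, uniformly in the first. -/
def BddSnd {V : Type*} [AddCommGroup V] (u : ℤ → ℤ → V) : Prop :=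
  ∃ m₀ : ℤ, ∀ m < m₀, ∀ n, u n m = 0

theorem BddSnd.sub {V : Type*} [AddCommGroup V] {u v : ℤ → ℤ → V} (hu : BddSnd u)
    (hv : BddSnd v) : BddSnd (u - v) := by
  obtain ⟨m₀, h⟩ := hu
  obtain ⟨m₁, h'⟩ := hv
  exact ⟨min m₀ m₁, fun m hm n => by
    simp [h m (lt_of_lt_of_le hm (min_le_left _ _)), h' m (lt_of_lt_of_le hm (min_le_right _ _))]⟩

theorem BddSnd.add {V : Type*} [AddCommGroup V] {u v : ℤ → ℤ → V} (hu : BddSnd u)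
    (hv : BddSnd v) : BddSnd (u + v) := by
  obtain ⟨m₀, h⟩ := hu
  obtain ⟨m₁, h'⟩ := hv
  exact ⟨min m₀ m₁, fun m hm n => by
    simp [h m (lt_of_lt_of_le hm (min_le_left _ _)), h' m (lt_of_lt_of_le hm (min_le_right _ _))]⟩

variable {U V : Type*} [AddCommGroup U] [Module ℂ U] [AddCommGroup V] [Module ℂ V]

variable (U) in
/-- Multiplication of `u(z, w) = ∑ z^n w^m u n m` by `z - w`. -/
def subMul : Module.End ℂ (ℤ → ℤ → U) where
  toFun u n m := u (n - 1) m - u n (m - 1)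
  map_add' u v := by ext n m; simp; abel
  map_smul' c u := by ext n m; simp [smul_sub]

theorem subMul_apply (u : ℤ → ℤ → U) (n m : ℤ) :
    subMul U u n m = u (n - 1) m - u n (m - 1) := rfl

/-- Multiplication by the expansion of `(z - w)^j` in non-negative powers of `w`. -/
noncomputable def expand (j : ℤ) (u : ℤ → ℤ → V) : ℤ → ℤ → V := fun n m =>
  ∑ᶠ l : ℕ, ((-1) ^ l * ((Ring.choose j l : ℤ) : ℂ)) • u (n - (j - l)) (m - l)

theorem BddSnd.mulSub {u : ℤ → ℤ → V} (hu : BddSnd u) : BddSnd (subMul V u) := by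
  obtain ⟨m₀, h⟩ := hu
  exact ⟨m₀, fun m hm n => by simp [subMul_apply, h m hm, h (m - 1) (by omega)]⟩

theorem BddSnd.smul {u : ℤ → ℤ → V} (c : ℂ) (hu : BddSnd u) : BddSnd (c • u) := by
  obtain ⟨m₀, h⟩ := hu
  exact ⟨m₀, fun m hm n => by simp [h m hm]⟩

theorem BddSnd.expand (j : ℤ) {u : ℤ → ℤ → V} (hu : BddSnd u) : BddSnd (expand j u) := by
  obtain ⟨m₀, h⟩ := hu
  refine ⟨m₀, fun m hm n => finsum_eq_zero_of_forall_eq_zero fun l => ?_⟩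
  rw [h _ (by omega), smul_zero]

theorem expand_eq_sum {u : ℤ → ℤ → V} {m₀ : ℤ} (h : ∀ m < m₀, ∀ n, u n m = 0) (j n m : ℤ) {R : ℕ}
    (hR : m - R < m₀) :
    expand j u n m = ∑ l ∈ Finset.range R,
      ((-1) ^ l * ((Ring.choose j l : ℤ) : ℂ)) • u (n - (j - l)) (m - l) := by
  refine finsum_eq_sum_of_support_subset _ fun l hl => ?_
  by_contra hlR
  refine hl ?_
  simp only [Finset.coe_range, Set.mem_Iio, not_lt] at hlR
  simp only
  rw [h _ (by omega), smul_zero]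

theorem expand_zero (u : ℤ → ℤ → V) : expand 0 u = u := by
  ext n m
  rw [expand, finsum_eq_single _ 0]
  · simp
  · intro l hl
    rw [Ring.choose_zero_pos ℤ (Nat.pos_of_ne_zero hl)]
    simp

/-- Pascal's rule, valid for negative `j` as well. Boundedness truncates all three sums; the one
shifted in `w` has one term fewer because its index `l` is matched with `l + 1`, leaving the `l = 0`
terms to be compared separately. -/
theorem subMul_expand (j : ℤ) {u : ℤ → ℤ → V} (hu : BddSnd u) :
    subMul V (expand j u) = expand (j + 1) u := by
  obtain ⟨m₀, h⟩ := hu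
  ext n m
  obtain ⟨R, hR⟩ : ∃ R : ℕ, m - R < m₀ := ⟨(m - m₀ + 1).toNat, by omega⟩
  rw [subMul_apply, expand_eq_sum h j (n - 1) m (R := R + 1) (by push_cast; omega),
    expand_eq_sum h j n (m - 1) (R := R) (by omega),
    expand_eq_sum h (j + 1) n m (R := R + 1) (by push_cast; omega),
    Finset.sum_range_succ', Finset.sum_range_succ', add_sub_right_comm, ← Finset.sum_sub_distrib]
  congr 1
  · refine Finset.sum_congr rfl fun l _ => ?_
    rw [Ring.choose_succ_succ]
    have h₁ : n - 1 - (j - ((l + 1 : ℕ) : ℤ)) = n - (j + 1 - ((l + 1 : ℕ) : ℤ)) := by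
      push_cast; ring
    have h₂ : n - (j - (l : ℤ)) = n - (j + 1 - ((l + 1 : ℕ) : ℤ)) := by push_cast; ring
    have h₃ : m - 1 - (l : ℤ) = m - ((l + 1 : ℕ) : ℤ) := by push_cast; ring
    rw [h₁, h₂, h₃, ← sub_smul]
    congr 1
    push_cast
    ring
  · simp only [Ring.choose_zero_right]
    congr 2
    push_cast
    ring

/-- A distribution killed by `z - w` is constant along each line of fixed `n + m`, and each such
line leaves the support as `m` decreases. Without boundedness the formal delta function is a
counterexample. -/
theorem subMul_injective {u : ℤ → ℤ → V} (hu : BddSnd u) (h : subMul V u = 0) : u = 0 := by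
  obtain ⟨m₀, h₀⟩ := hu
  have hstep : ∀ n m, u n m = u (n + 1) (m - 1) := by
    intro n m
    have := congr_fun (congr_fun h (n + 1)) m
    simpa [subMul_apply, sub_eq_zero] using this
  have hiter : ∀ (k : ℕ) (n m : ℤ), u n m = u (n + k) (m - k) := by
    intro k
    induction k with
    | zero => intro n m; simp
    | succ k ih =>
      intro n m
      rw [ih, hstep]
      congr 1 <;> push_cast <;> ring
  ext n m
  rw [hiter (m - m₀ + 1).toNat, h₀ _ (by omega)]
  rfl

theorem subMul_pow_injective {u : ℤ → ℤ → V} (k : ℕ) (hu : BddSnd u)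
    (h : (subMul V ^ k) u = 0) : u = 0 := by
  induction k generalizing u with
  | zero => simpa using h
  | succ k ih =>
    rw [pow_succ, Module.End.mul_apply] at h
    exact subMul_injective hu (ih hu.mulSub h)

/-- A family of distributions `F` over `j ∈ ℤ` with `(z - w) F_j = F_{j+1}` is determined by `F_0`
among the families bounded below in `w`. -/
theorem expand_unique {u : ℤ → ℤ → V} (hu : BddSnd u) {F : ℤ → ℤ → ℤ → V} (hF : ∀ j, BddSnd (F j))
    (hF₀ : F 0 = u) (hs : ∀ j, subMul V (F j) = F (j + 1)) (j : ℤ) : F j = expand j u := by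
  induction j using Int.induction_on with
  | zero => rw [hF₀, expand_zero]
  | succ j ih => rw [← hs, ih, subMul_expand _ hu]
  | pred j ih =>
    -- Descending in `j` would mean dividing by `z - w`; injectivity reduces the claim to the known
    -- one at the next higher exponent.
    rw [← sub_eq_zero]
    refine subMul_injective ((hF _).sub (hu.expand _)) ?_
    · rw [map_sub, hs, subMul_expand _ hu]
      simpa [sub_eq_zero] using ih

/-- Operators on families of distributions that commute with multiplication by `z - w` commute with
multiplication by the expansion of `(z - w)^j`. -/
theorem expand_comm {ι ι' : Type*} (Φ : (ι → ℤ → ℤ → U) → ι' → ℤ → ℤ → V)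
    (hΦ : ∀ u i, Φ (fun i => subMul U (u i)) i = subMul V (Φ u i))
    (hb : ∀ u, (∀ i, BddSnd (u i)) → ∀ i, BddSnd (Φ u i)) {u : ι → ℤ → ℤ → U}
    (hu : ∀ i, BddSnd (u i)) (j : ℤ) (i : ι') :
    Φ (fun i => expand j (u i)) i = expand j (Φ u i) := by
  refine expand_unique (hb u hu i) (F := fun j => Φ (fun i => expand j (u i)) i)
    (fun j => hb _ (fun i => (hu i).expand j) i) (by simp [expand_zero]) (fun j => ?_) j
  rw [← hΦ]
  simp only [subMul_expand _ (hu _)]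

/-- The sum of the two families obeys the recursion that characterises the expansion of `u + v`. -/
theorem expand_add (j : ℤ) {u v : ℤ → ℤ → V} (hu : BddSnd u) (hv : BddSnd v) :
    expand j (u + v) = expand j u + expand j v := by
  refine (expand_unique (hu.add hv) (F := fun j => expand j u + expand j v)
    (fun j => (hu.expand j).add (hv.expand j)) (by simp [expand_zero]) (fun j => ?_) j).symm
  simp [subMul_expand _ hu, subMul_expand _ hv]

theorem expand_smul (j : ℤ) (c : ℂ) (u : ℤ → ℤ → V) :
    expand j (c • u) = c • expand j u := by
  ext n m
  simp only [expand, Pi.smul_apply]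
  rw [smul_finsum]
  exact finsum_congr fun l => smul_comm _ _ _

theorem expand_sub (j : ℤ) {u v : ℤ → ℤ → V} (hu : BddSnd u) (hv : BddSnd v) :
    expand j (u - v) = expand j u - expand j v := by
  rw [sub_eq_add_neg, ← neg_one_smul ℂ, expand_add j hu (hv.smul _), expand_smul, neg_one_smul,
    ← sub_eq_add_neg]

theorem expand_zero_right (j : ℤ) : expand j (0 : ℤ → ℤ → V) = 0 := by
  ext n m
  simp [expand]

theorem map_expand (X : U →ₗ[ℂ] V) (j : ℤ) {u : ℤ → ℤ → U} (hu : BddSnd u) (n m : ℤ) :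
    X (expand j u n m) = expand j (fun n m => X (u n m)) n m := by
  have := expand_comm (ι := Unit) (ι' := Unit) (fun u _ n m => X (u () n m))
    (fun u _ => by ext n m; simp [subMul_apply])
    (fun u h _ => by
      obtain ⟨m₀, h⟩ := h ()
      exact ⟨m₀, fun m hm n => by simp [h m hm]⟩) (u := fun _ => u) (fun _ => hu) j ()
  exact congr_fun (congr_fun this n) m

end Expansion

/-! ### Products of fields in one even variable -/

section Fields

variable {V : Type*} [AddCommGroup V] [Module ℂ V]

/-- `f(z) v` has finitely many negative powers of `z`, for every `v`. -/
def IsField (f : ℤ → Module.End ℂ V) : Prop := ∀ v, ∃ n₀ : ℤ, ∀ n < n₀, f n v = 0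

/-- The coefficients of `f(z) g(w) v`. -/
def comp₂ (f g : ℤ → Module.End ℂ V) (v : V) : ℤ → ℤ → V := fun n m => f n (g m v)

theorem IsField.bddSnd_comp₂ (f : ℤ → Module.End ℂ V) {g : ℤ → Module.End ℂ V} (hg : IsField g)
    (v : V) : BddSnd (comp₂ f g v) := by
  obtain ⟨m₀, h⟩ := hg v
  exact ⟨m₀, fun m hm n => by simp [comp₂, h m hm]⟩

/-- The coefficients of `i_{z,w}(z-w)^j f(z) g(w) v - ε i_{w,z}(z-w)^j g(w) f(z) v`. -/
noncomputable def bracketExpand (ε : ℂ) (j : ℤ) (f g : ℤ → Module.End ℂ V) (v : V) : ℤ → ℤ → V :=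
  fun n m => expand j (comp₂ f g v) n m - (ε * (-1) ^ j) • expand j (comp₂ g f v) m n

/-- The second term of the bracket is an expansion of `(w-z)^j` with transposed indices. Multiplying
it by `z - w` changes its sign, which is what passing from `(-1)^j` to `(-1)^(j+1)` records. -/
theorem subMul_bracketExpand (ε : ℂ) (j : ℤ) {f g : ℤ → Module.End ℂ V} (hf : IsField f)
    (hg : IsField g) (v : V) :
    subMul V (bracketExpand ε j f g v) = bracketExpand ε (j + 1) f g v := by
  ext n m
  have h₁ := congr_fun (congr_fun (subMul_expand j (hg.bddSnd_comp₂ f v)) n) m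
  have h₂ := congr_fun (congr_fun (subMul_expand j (hf.bddSnd_comp₂ g v)) m) n
  rw [subMul_apply] at h₁ h₂ ⊢
  simp only [bracketExpand]
  rw [← h₁, ← h₂, zpow_add_one₀ (by norm_num)]
  module

theorem subMul_pow_bracketExpand (ε : ℂ) (j : ℤ) {f g : ℤ → Module.End ℂ V} (hf : IsField f)
    (hg : IsField g) (v : V) (k : ℕ) :
    (subMul V ^ k) (bracketExpand ε j f g v) = bracketExpand ε (j + k) f g v := by
  induction k with
  | zero => simp
  | succ k ih =>
    rw [pow_succ', Module.End.mul_apply, ih, subMul_bracketExpand ε _ hf hg]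
    congr 1
    push_cast
    ring

/-- The commutator `f(z) g(w) - ε g(w) f(z)`. -/
def epsBracket (ε : ℂ) (f g : ℤ → Module.End ℂ V) : ℤ → ℤ → Module.End ℂ V :=
  fun n m => f n * g m - ε • (g m * f n)

/-- Locality of two fields that commute up to the factor `ε`. -/
def EpsLocal (ε : ℂ) (f g : ℤ → Module.End ℂ V) : Prop :=
  ∃ n : ℕ, (subMul (Module.End ℂ V) ^ n) (epsBracket ε f g) = 0

theorem subMul_pow_eq_zero_of_le {U : Type*} [AddCommGroup U] [Module ℂ U] {u : ℤ → ℤ → U}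
    {n k : ℕ} (h : (subMul U ^ n) u = 0) (hk : n ≤ k) : (subMul U ^ k) u = 0 := by
  obtain ⟨r, rfl⟩ := Nat.exists_eq_add_of_le hk
  rw [add_comm, pow_add, Module.End.mul_apply, h, map_zero]

/-- If `Ψ` intertwines `P` and `Q`, it intertwines their powers. -/
theorem pow_intertwine {X Y : Type*} [AddCommGroup X] [Module ℂ X] [AddCommGroup Y] [Module ℂ Y]
    {P : Module.End ℂ X} {Q : Module.End ℂ Y} (Ψ : X → Y) (h : ∀ x, Ψ (P x) = Q (Ψ x)) (n : ℕ)
    (x : X) : Ψ ((P ^ n) x) = (Q ^ n) (Ψ x) := by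
  induction n with
  | zero => simp
  | succ n ih => rw [pow_succ', Module.End.mul_apply, h, ih, pow_succ', Module.End.mul_apply]

/-- The two brackets are proportional by `-ε'` after exchanging the variables, and the exchange
turns each factor `z - w` into its negative. -/
theorem EpsLocal.symm {ε ε' : ℂ} (hε : ε * ε' = 1) {f g : ℤ → Module.End ℂ V}
    (h : EpsLocal ε f g) : EpsLocal ε' g f := by
  obtain ⟨n, hn⟩ := h
  refine ⟨n, ?_⟩
  have key : ∀ k : ℕ, (subMul (Module.End ℂ V) ^ k) (epsBracket ε' g f) =
      fun n m => (-ε' * (-1) ^ k) • (subMul (Module.End ℂ V) ^ k) (epsBracket ε f g) m n := by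
    intro k
    induction k with
    | zero =>
      ext1 n; ext1 m
      simp only [epsBracket, pow_zero, Module.End.one_apply, smul_sub, smul_smul]
      rw [show -ε' * 1 * ε = -1 by linear_combination -hε]
      module
    | succ k ih =>
      rw [pow_succ', Module.End.mul_apply, ih, pow_succ', Module.End.mul_apply]
      ext1 n; ext1 m
      simp only [subMul_apply]
      module
  rw [key, hn]
  ext1 n; ext1 m
  simp

/-- For `j ≥ 0` the two expansions of `(z-w)^j` are the same polynomial, so the bracket is `(z-w)^j
[f(z), g(w)] v`. -/
theorem EpsLocal.bracketExpand_eq_zero {ε : ℂ} {f g : ℤ → Module.End ℂ V} {n : ℕ}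
    (h : (subMul (Module.End ℂ V) ^ n) (epsBracket ε f g) = 0) (hf : IsField f)
    (hg : IsField g) {j : ℤ} (hj : n ≤ j) (v : V) : bracketExpand ε j f g v = 0 := by
  obtain ⟨k, rfl⟩ := Int.eq_ofNat_of_zero_le (by omega : 0 ≤ j)
  have h₀ : bracketExpand ε 0 f g v = fun n m => epsBracket ε f g n m v := by
    ext n m
    simp [bracketExpand, expand_zero, comp₂, epsBracket]
  have := subMul_pow_bracketExpand ε 0 hf hg v k
  rw [zero_add] at this
  rw [← this, h₀, ← pow_intertwine (P := subMul (Module.End ℂ V))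
    (fun (u : ℤ → ℤ → Module.End ℂ V) n m => u n m v) (fun u => by ext n m; simp [subMul_apply]),
    subMul_pow_eq_zero_of_le h (by omega)]
  rfl

end Fields

section FieldProd

variable {V : Type*} [AddCommGroup V] [Module ℂ V]

theorem bracketExpand_add (ε : ℂ) (j : ℤ) {f g : ℤ → Module.End ℂ V} (hf : IsField f)
    (hg : IsField g) (v w : V) :
    bracketExpand ε j f g (v + w) = bracketExpand ε j f g v + bracketExpand ε j f g w := by
  have hc : ∀ f g : ℤ → Module.End ℂ V, comp₂ f g (v + w) = comp₂ f g v + comp₂ f g w := by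
    intro f g
    ext n m
    simp [comp₂]
  ext n m
  simp only [bracketExpand, hc, expand_add j (hg.bddSnd_comp₂ f v) (hg.bddSnd_comp₂ f w),
    expand_add j (hf.bddSnd_comp₂ g v) (hf.bddSnd_comp₂ g w), Pi.add_apply]
  module

theorem bracketExpand_smul (ε : ℂ) (j : ℤ) (f g : ℤ → Module.End ℂ V) (c : ℂ) (v : V) :
    bracketExpand ε j f g (c • v) = c • bracketExpand ε j f g v := by
  have hc : ∀ f g : ℤ → Module.End ℂ V, comp₂ f g (c • v) = c • comp₂ f g v := by
    intro f g
    ext n m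
    simp [comp₂]
  ext n m
  simp only [bracketExpand, hc, expand_smul, Pi.smul_apply]
  module

/-- The `j`-th product `res_z (i_{z,w}(z-w)^j f(z) g(w) - ε i_{w,z}(z-w)^j g(w) f(z))`. -/
noncomputable def fieldProd (ε : ℂ) (j : ℤ) {f g : ℤ → Module.End ℂ V} (hf : IsField f)
    (hg : IsField g) : ℤ → Module.End ℂ V := fun m =>
  { toFun v := bracketExpand ε j f g v (-1) m
    map_add' v w := by rw [bracketExpand_add ε j hf hg]; rfl
    map_smul' c v := by rw [bracketExpand_smul]; rfl }

/-! ### Dong's lemma -/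

variable (V) in
/-- Multiplication by `z₁ - z₃` of `u(z₁, z₂, z₃) = ∑ z₁^n z₂^m z₃^k u k n m`. -/
def subMul₁₃ : Module.End ℂ (ℤ → ℤ → ℤ → V) where
  toFun u k n m := u k (n - 1) m - u (k - 1) n m
  map_add' u v := by ext k n m; simp; abel
  map_smul' c u := by ext k n m; simp [smul_sub]

variable (V) in
/-- Multiplication by `z₂ - z₃` of `u(z₁, z₂, z₃) = ∑ z₁^n z₂^m z₃^k u k n m`. -/
def subMul₂₃ : Module.End ℂ (ℤ → ℤ → ℤ → V) where
  toFun u k n m := u k n (m - 1) - u (k - 1) n m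
  map_add' u v := by ext k n m; simp; abel
  map_smul' c u := by ext k n m; simp [smul_sub]

variable (V) in
/-- Multiplication by `z₁ - z₂` of `u(z₁, z₂, z₃) = ∑ z₁^n z₂^m z₃^k u k n m`. -/
def subMul₁₂ : Module.End ℂ (ℤ → ℤ → ℤ → V) where
  toFun u k := subMul V (u k)
  map_add' u v := by ext k n m; simp
  map_smul' c u := by ext k n m; simp

theorem subMul₁₃_apply (u : ℤ → ℤ → ℤ → V) (k n m : ℤ) :
    subMul₁₃ V u k n m = u k (n - 1) m - u (k - 1) n m := rfl

theorem subMul₂₃_apply (u : ℤ → ℤ → ℤ → V) (k n m : ℤ) :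
    subMul₂₃ V u k n m = u k n (m - 1) - u (k - 1) n m := rfl

theorem subMul₁₂_apply (u : ℤ → ℤ → ℤ → V) (k : ℤ) : subMul₁₂ V u k = subMul V (u k) := rfl

theorem subMul₂₃_eq : subMul₂₃ V = subMul₁₃ V - subMul₁₂ V := by
  ext u k n m
  simp [subMul₂₃_apply, subMul₁₃_apply, subMul₁₂_apply, subMul_apply]

theorem commute_subMul₁₃_subMul₁₂ : Commute (subMul₁₃ V) (subMul₁₂ V) := by
  ext u k n m
  simp only [Module.End.mul_apply, subMul₁₃_apply, subMul₁₂_apply, subMul_apply]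
  abel

theorem commute_subMul₁₃_subMul₂₃ : Commute (subMul₁₃ V) (subMul₂₃ V) := by
  rw [subMul₂₃_eq]
  exact (Commute.refl _).sub_right commute_subMul₁₃_subMul₁₂

/-- Each monomial of the binomial expansion contains `P ^ r` or `Q ^ s`. The induction avoids
binomials: after one factor `P - Q`, the vector `P x` needs one power of `P` less and `Q x` one
power of `Q` less. -/
theorem sub_pow_apply_eq_zero {X : Type*} [AddCommGroup X] [Module ℂ X] {P Q : Module.End ℂ X}
    (hPQ : Commute P Q) (n : ℕ) {r s : ℕ} (hn : r + s ≤ n) {x : X} (hP : (P ^ r) x = 0)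
    (hQ : (Q ^ s) x = 0) : ((P - Q) ^ n) x = 0 := by
  induction n generalizing r s x with
  | zero =>
    obtain rfl : r = 0 := by omega
    simpa using hP
  | succ n ih =>
    rcases r with - | r
    · rw [show x = 0 by simpa using hP, map_zero]
    rcases s with - | s
    · rw [show x = 0 by simpa using hQ, map_zero]
    rw [pow_succ, Module.End.mul_apply, LinearMap.sub_apply, map_sub,
      ih (r := r) (s := s + 1) (by omega), ih (r := r + 1) (s := s) (by omega), sub_zero]
    · rw [← Module.End.mul_apply, (hPQ.pow_left _).eq, Module.End.mul_apply, hP, map_zero]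
    · rwa [pow_succ, Module.End.mul_apply] at hQ
    · rwa [pow_succ, Module.End.mul_apply] at hP
    · rw [← Module.End.mul_apply, ← (hPQ.pow_right _).eq, Module.End.mul_apply, hQ, map_zero]

/-- Boundedness is proved along with the commutation because `expand_comm` needs it at every power.
-/
theorem pow_expand_comm {P : Module.End ℂ (ℤ → ℤ → ℤ → V)} (hP : Commute P (subMul₁₂ V))
    (hb : ∀ u : ℤ → ℤ → ℤ → V, (∀ k, BddSnd (u k)) → ∀ k, BddSnd (P u k)) (r : ℕ) (j : ℤ)
    {u : ℤ → ℤ → ℤ → V} (hu : ∀ k, BddSnd (u k)) :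
    (∀ k, BddSnd ((P ^ r) u k)) ∧
      (P ^ r) (fun k => expand j (u k)) = fun k => expand j ((P ^ r) u k) := by
  induction r with
  | zero => exact ⟨by simpa using hu, by simp⟩
  | succ r ih =>
    simp only [pow_succ', Module.End.mul_apply]
    refine ⟨hb _ ih.1, ?_⟩
    rw [ih.2]
    ext1 k
    exact expand_comm (fun u => P u) (fun u i => congr_fun (LinearMap.congr_fun hP.eq u) i) hb
      ih.1 j k

theorem bddSnd_subMul₁₃ (u : ℤ → ℤ → ℤ → V) (hu : ∀ k, BddSnd (u k)) (k : ℤ) :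
    BddSnd (subMul₁₃ V u k) := by
  obtain ⟨m₀, h⟩ := hu k
  obtain ⟨m₁, h'⟩ := hu (k - 1)
  exact ⟨min m₀ m₁, fun m hm n => by
    simp [subMul₁₃_apply, h m (lt_of_lt_of_le hm (min_le_left _ _)),
      h' m (lt_of_lt_of_le hm (min_le_right _ _))]⟩

theorem bddSnd_subMul₂₃ (u : ℤ → ℤ → ℤ → V) (hu : ∀ k, BddSnd (u k)) (k : ℤ) :
    BddSnd (subMul₂₃ V u k) := by
  rw [subMul₂₃_eq]
  exact (bddSnd_subMul₁₃ u hu k).sub (hu k).mulSub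

/-- The coefficients of `f(z₁) g(z₂) h(z₃) v - ε h(z₃) f(z₁) g(z₂) v`. -/
def comp₃ (ε : ℂ) (f g h : ℤ → Module.End ℂ V) (v : V) : ℤ → ℤ → ℤ → V :=
  fun k => comp₂ f g (h k v) - ε • fun n m => h k (comp₂ f g v n m)

theorem bddSnd_map {u : ℤ → ℤ → V} (X : Module.End ℂ V) (hu : BddSnd u) :
    BddSnd fun n m => X (u n m) := by
  obtain ⟨m₀, h⟩ := hu
  exact ⟨m₀, fun m hm n => by simp [h m hm]⟩

theorem bddSnd_comp₃ (ε : ℂ) (f : ℤ → Module.End ℂ V) {g : ℤ → Module.End ℂ V} (hg : IsField g)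
    (h : ℤ → Module.End ℂ V) (v : V) (k : ℤ) : BddSnd (comp₃ ε f g h v k) :=
  (hg.bddSnd_comp₂ f _).sub ((bddSnd_map _ (hg.bddSnd_comp₂ f v)).smul _)

theorem expand_comp₃ (ε : ℂ) (f : ℤ → Module.End ℂ V) {g : ℤ → Module.End ℂ V} (hg : IsField g)
    (h : ℤ → Module.End ℂ V) (v : V) (j k n m : ℤ) :
    expand j (comp₃ ε f g h v k) n m =
      expand j (comp₂ f g (h k v)) n m - ε • h k (expand j (comp₂ f g v) n m) := by
  rw [comp₃, expand_sub j (hg.bddSnd_comp₂ f _) ((bddSnd_map _ (hg.bddSnd_comp₂ f v)).smul _),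
    expand_smul, map_expand _ _ (hg.bddSnd_comp₂ f v)]
  rfl

/-- Insert `ε₃ f h g`: the commutator `f g h - ε₂ ε₃ h f g` is `f [g, h] + ε₃ [f, h] g`. A power of
`z₂ - z₃` kills the first summand and a power of `z₁ - z₃` the second. -/
theorem subMul_pow_comp₃ {ε₂ ε₃ : ℂ} {f g h : ℤ → Module.End ℂ V} {r s : ℕ}
    (hfh : (subMul (Module.End ℂ V) ^ r) (epsBracket ε₂ f h) = 0)
    (hgh : (subMul (Module.End ℂ V) ^ s) (epsBracket ε₃ g h) = 0) (v : V) :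
    (subMul₁₃ V ^ r) ((subMul₂₃ V ^ s) (comp₃ (ε₂ * ε₃) f g h v)) = 0 := by
  let Ψ₁ : (ℤ → ℤ → Module.End ℂ V) → ℤ → ℤ → ℤ → V := fun w k n m => f n (w m k v)
  let Ψ₂ : (ℤ → ℤ → Module.End ℂ V) → ℤ → ℤ → ℤ → V := fun w k n m => ε₃ • w n k (g m v)
  have hsum : comp₃ (ε₂ * ε₃) f g h v = Ψ₁ (epsBracket ε₃ g h) + Ψ₂ (epsBracket ε₂ f h) := by
    ext k n m
    simp only [comp₃, comp₂, Ψ₁, Ψ₂, epsBracket, Pi.sub_apply, Pi.smul_apply, Pi.add_apply,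
      LinearMap.sub_apply, LinearMap.smul_apply, Module.End.mul_apply, map_sub, map_smul]
    module
  have h₁ : (subMul₂₃ V ^ s) (Ψ₁ (epsBracket ε₃ g h)) = 0 := by
    rw [← pow_intertwine (P := subMul (Module.End ℂ V)) Ψ₁, hgh]
    · ext k n m; simp [Ψ₁]
    · intro w
      ext k n m
      simp [Ψ₁, subMul_apply, subMul₂₃_apply]
  have h₂ : (subMul₁₃ V ^ r) (Ψ₂ (epsBracket ε₂ f h)) = 0 := by
    rw [← pow_intertwine (P := subMul (Module.End ℂ V)) Ψ₂, hfh]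
    · ext k n m; simp [Ψ₂]
    · intro w
      ext k n m
      simp [Ψ₂, subMul_apply, subMul₁₃_apply, smul_sub]
  rw [hsum, map_add, h₁, zero_add, ← Module.End.mul_apply,
    ((commute_subMul₁₃_subMul₂₃.pow_left r).pow_right s).eq, Module.End.mul_apply, h₂, map_zero]

theorem subMul_pow_expand_comp₃ {ε₂ ε₃ : ℂ} {f g h : ℤ → Module.End ℂ V} (hg : IsField g) {r s : ℕ}
    (hfh : (subMul (Module.End ℂ V) ^ r) (epsBracket ε₂ f h) = 0)
    (hgh : (subMul (Module.End ℂ V) ^ s) (epsBracket ε₃ g h) = 0) (j : ℤ) (v : V) :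
    (subMul₁₃ V ^ r) ((subMul₂₃ V ^ s)
      fun k => expand j (comp₃ (ε₂ * ε₃) f g h v k)) = 0 := by
  have h₂₃ : Commute (subMul₂₃ V) (subMul₁₂ V) := by
    rw [subMul₂₃_eq]
    exact commute_subMul₁₃_subMul₁₂.sub_left (Commute.refl _)
  have h₁ := pow_expand_comm h₂₃ bddSnd_subMul₂₃ s j (bddSnd_comp₃ (ε₂ * ε₃) f hg h v)
  rw [h₁.2, (pow_expand_comm commute_subMul₁₃_subMul₁₂ bddSnd_subMul₁₃ r j h₁.1).2,
    subMul_pow_comp₃ hfh hgh]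
  ext1 k
  exact expand_zero_right j

/-- Dong's lemma. -/
theorem EpsLocal.fieldProd {ε ε₂ ε₃ : ℂ} {f g h : ℤ → Module.End ℂ V} (hf : IsField f)
    (hg : IsField g) (hfg : EpsLocal ε f g) (hfh : EpsLocal ε₂ f h)
    (hgh : EpsLocal ε₃ g h) (j : ℤ) : EpsLocal (ε₂ * ε₃) (fieldProd ε j hf hg) h := by
  obtain ⟨t, ht⟩ := hfg
  obtain ⟨r, hr⟩ := hfh
  obtain ⟨s, hs⟩ := hgh
  obtain ⟨d, hd⟩ : ∃ d : ℕ, (t : ℤ) ≤ j + d := ⟨(t - j).toNat, by omega⟩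
  refine ⟨r + d + s, ?_⟩
  let flip : (ℤ → ℤ → ℤ → V) → ℤ → ℤ → ℤ → V := fun u k n m => u k m n
  have flip₁₃ : ∀ u : ℤ → ℤ → ℤ → V, flip (subMul₁₃ V u) = subMul₂₃ V (flip u) := fun _ => rfl
  have flip₂₃ : ∀ u : ℤ → ℤ → ℤ → V, flip (subMul₂₃ V u) = subMul₁₃ V (flip u) := fun _ => rfl
  ext n k v
  -- `X` is the commutator of the whole bracket of `f(z₁)` and `g(z₂)` with `h(z₃)`, before the
  -- residue in `z₁`. Its second half is the first with `f` and `g` exchanged, which is why `flip`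
  -- appears below.
  let X : ℤ → ℤ → ℤ → V := fun k => bracketExpand ε j f g (h k v) -
    (ε₂ * ε₃) • fun n m => h k (bracketExpand ε j f g v n m)
  have hX : X = (fun k => expand j (comp₃ (ε₂ * ε₃) f g h v k)) -
      (ε * (-1) ^ j) • flip (fun k => expand j (comp₃ (ε₃ * ε₂) g f h v k)) := by
    ext k n m
    simp only [X, flip, Pi.sub_apply, Pi.smul_apply, expand_comp₃ _ f hg, expand_comp₃ _ g hf,
      bracketExpand, map_sub, map_smul]
    module
  have hC : (subMul₁₃ V ^ r) ((subMul₂₃ V ^ s) X) = 0 := by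
    rw [hX, map_sub, map_sub, subMul_pow_expand_comp₃ hg hr hs, map_smul, map_smul,
      ← pow_intertwine flip flip₁₃, ← pow_intertwine flip flip₂₃, ← Module.End.mul_apply,
      ← ((commute_subMul₁₃_subMul₂₃.pow_left s).pow_right r).eq, Module.End.mul_apply,
      subMul_pow_expand_comp₃ hf hs hr, show flip 0 = 0 from rfl, smul_zero, sub_zero]
  have hB : (subMul₁₂ V ^ d) X = 0 := by
    ext1 k
    rw [pow_intertwine (P := subMul₁₂ V) (Q := subMul V) (fun u => u k) (fun _ => rfl) d X]
    simp only [X]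
    rw [map_sub, map_smul, ← pow_intertwine (P := subMul V) (Q := subMul V)
      (fun u n m => h k (u n m)) (fun u => by ext n m; simp [subMul_apply]),
      subMul_pow_bracketExpand ε j hf hg, subMul_pow_bracketExpand ε j hf hg,
      EpsLocal.bracketExpand_eq_zero ht hf hg hd, EpsLocal.bracketExpand_eq_zero ht hf hg hd]
    ext n m
    simp
  -- Write `r + d` of the factors as `z₂ - z₃ = (z₁ - z₃) - (z₁ - z₂)`. On `(z₂ - z₃)^s X`, `r`
  -- factors `z₁ - z₃` vanish by locality with `h`, and `d` factors `z₁ - z₂` vanish by locality of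
  -- `f` and `g`.
  have hCX : (subMul₂₃ V ^ (r + d + s)) X = 0 := by
    rw [pow_add, Module.End.mul_apply]
    nth_rewrite 1 [subMul₂₃_eq]
    refine sub_pow_apply_eq_zero commute_subMul₁₃_subMul₁₂ _ le_rfl hC ?_
    have hc : Commute (subMul₁₂ V) (subMul₂₃ V) := by
      rw [subMul₂₃_eq]
      exact commute_subMul₁₃_subMul₁₂.symm.sub_right (Commute.refl _)
    rw [← Module.End.mul_apply, ((hc.pow_left d).pow_right s).eq, Module.End.mul_apply, hB,
      map_zero]
  have h₁ := pow_intertwine (P := subMul (Module.End ℂ V)) (Q := subMul V)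
    (fun (w : ℤ → ℤ → Module.End ℂ V) m k => w m k v)
    (fun u => by ext n m; simp [subMul_apply]) (r + d + s)
    (epsBracket (ε₂ * ε₃) (SUSY.fieldProd ε j hf hg) h)
  -- Taking the coefficient of `z₁^(-1)` commutes with `z₂ - z₃`, so the vanishing descends to the
  -- product.
  have h₂ := pow_intertwine (P := subMul₂₃ V) (Q := subMul V)
    (fun (u : ℤ → ℤ → ℤ → V) m k => u k (-1) m) (fun u => rfl) (r + d + s) X
  rw [hCX] at h₂
  exact (congr_fun (congr_fun (h₁.trans h₂.symm) n) k)

/-! ### Derivations -/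

theorem fieldProd_apply (ε : ℂ) (j : ℤ) {f g : ℤ → Module.End ℂ V} (hf : IsField f)
    (hg : IsField g) (v : V) (m : ℤ) : fieldProd ε j hf hg m v =
      bracketExpand ε j f g v (-1) m := rfl

/-- An operator `X` that satisfies a twisted Leibniz rule on `f` and `g` satisfies it on their
products. -/
theorem fieldProd_derivation {f g f' g' : ℤ → Module.End ℂ V} (hf : IsField f)
    (hg : IsField g) (hf' : IsField f') (hg' : IsField g') {X : Module.End ℂ V} {s t : ℂ}
    (hs : s * s = 1) (hXf : ∀ n, X * f n - s • (f n * X) = f' n)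
    (hXg : ∀ n, X * g n - t • (g n * X) = g' n) (ε : ℂ) (j m : ℤ) :
    X * fieldProd ε j hf hg m - (s * t) • (fieldProd ε j hf hg m * X) =
      fieldProd (ε * t) j hf' hg m + s • fieldProd (ε * s) j hf hg' m := by
  have hXf' : ∀ n v, X (f n v) = s • f n (X v) + f' n v := fun n v => by
    rw [← hXf]; simp
  have hXg' : ∀ n v, X (g n v) = t • g n (X v) + g' n v := fun n v => by
    rw [← hXg]; simp
  have e₁ : ∀ v, (fun n m => X (comp₂ f g v n m)) =
      (s * t) • comp₂ f g (X v) + (s • comp₂ f g' v + comp₂ f' g v) := by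
    intro v
    ext n m
    simp only [comp₂, hXf', hXg', map_add, map_smul, Pi.add_apply, Pi.smul_apply]
    module
  have e₂ : ∀ v, (fun n m => X (comp₂ g f v n m)) =
      (s * t) • comp₂ g f (X v) + (t • comp₂ g f' v + comp₂ g' f v) := by
    intro v
    ext n m
    simp only [comp₂, hXf', hXg', map_add, map_smul, Pi.add_apply, Pi.smul_apply]
    module
  ext v
  simp only [LinearMap.sub_apply, LinearMap.smul_apply, LinearMap.add_apply, Module.End.mul_apply,
    fieldProd_apply, bracketExpand, map_sub, map_smul, map_expand X j (hg.bddSnd_comp₂ f v),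
    map_expand X j (hf.bddSnd_comp₂ g v), e₁, e₂,
    expand_add j ((hg.bddSnd_comp₂ f (X v)).smul (s * t))
      (((hg'.bddSnd_comp₂ f v).smul s).add (hg.bddSnd_comp₂ f' v)),
    expand_add j ((hg'.bddSnd_comp₂ f v).smul s) (hg.bddSnd_comp₂ f' v),
    expand_add j ((hf.bddSnd_comp₂ g (X v)).smul (s * t))
      (((hf'.bddSnd_comp₂ g v).smul t).add (hf.bddSnd_comp₂ g' v)),
    expand_add j ((hf'.bddSnd_comp₂ g v).smul t) (hf.bddSnd_comp₂ g' v), expand_smul,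
    Pi.add_apply, Pi.smul_apply]
  -- Only the term `g' f` needs `s * s = 1`: it occurs with coefficient `ε` on the left and `s * (ε
  -- * s)` on the right, up to the same sign.
  match_scalars <;> first | ring1 | linear_combination (ε * (-1) ^ j) * hs

/-- `∂_z + ∂_w` annihilates `z - w`, hence commutes with multiplication by it and with the
expansions. -/
theorem expand_dz (j : ℤ) {u : ℤ → ℤ → V} (hu : BddSnd u) (n m : ℤ) :
    expand j (fun n m => ((n : ℂ) + 1) • u (n + 1) m + ((m : ℂ) + 1) • u n (m + 1)) n m =
      ((n : ℂ) + 1) • expand j u (n + 1) m + ((m : ℂ) + 1) • expand j u n (m + 1) := by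
  have := expand_comm (ι := Unit) (ι' := Unit) (fun u _ n m =>
    ((n : ℂ) + 1) • u () (n + 1) m + ((m : ℂ) + 1) • u () n (m + 1))
    (fun u _ => by
      ext n m
      simp only [subMul_apply, sub_add_cancel, add_sub_cancel_right]
      push_cast
      module)
    (fun u h _ => by
      obtain ⟨m₀, h⟩ := h ()
      exact ⟨m₀ - 1, fun m hm n => by simp [h m (by omega), h (m + 1) (by omega)]⟩)
    (u := fun _ => u) (fun _ => hu) j ()
  exact (congr_fun (congr_fun this n) m).symm

theorem fieldProd_translation {f g : ℤ → Module.End ℂ V} (hf : IsField f)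
    (hg : IsField g) {T : Module.End ℂ V}
    (hTf : ∀ n : ℤ, T * f n - f n * T = ((n : ℂ) + 1) • f (n + 1))
    (hTg : ∀ n : ℤ, T * g n - g n * T = ((n : ℂ) + 1) • g (n + 1)) (ε : ℂ) (j m : ℤ) :
    T * fieldProd ε j hf hg m - fieldProd ε j hf hg m * T =
      ((m : ℂ) + 1) • fieldProd ε j hf hg (m + 1) := by
  have hTf' : ∀ n v, T (f n v) = f n (T v) + ((n : ℂ) + 1) • f (n + 1) v := fun n v => by
    rw [← LinearMap.smul_apply, ← hTf]; simp
  have hTg' : ∀ n v, T (g n v) = g n (T v) + ((n : ℂ) + 1) • g (n + 1) v := fun n v => by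
    rw [← LinearMap.smul_apply, ← hTg]; simp
  have e₁ : ∀ v, (fun n m => T (comp₂ f g v n m)) - comp₂ f g (T v) = fun (n m : ℤ) =>
      ((n : ℂ) + 1) • comp₂ f g v (n + 1) m + ((m : ℂ) + 1) • comp₂ f g v n (m + 1) := by
    intro v
    ext n m
    simp only [comp₂, hTf', hTg', map_add, map_smul, Pi.sub_apply]
    module
  have e₂ : ∀ v, (fun n m => T (comp₂ g f v n m)) - comp₂ g f (T v) = fun (n m : ℤ) =>
      ((n : ℂ) + 1) • comp₂ g f v (n + 1) m + ((m : ℂ) + 1) • comp₂ g f v n (m + 1) := by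
    intro v
    ext n m
    simp only [comp₂, hTf', hTg', map_add, map_smul, Pi.sub_apply]
    module
  ext v
  -- At exponent `-1` the factor `n + 1` is zero: the residue of a `z`-derivative vanishes and only
  -- `∂_w` survives.
  have h₁ := expand_dz j (hg.bddSnd_comp₂ f v) (-1) m
  have h₂ := expand_dz j (hf.bddSnd_comp₂ g v) m (-1)
  rw [← e₁, expand_sub j (bddSnd_map T (hg.bddSnd_comp₂ f v)) (hg.bddSnd_comp₂ f (T v)),
    Pi.sub_apply, Pi.sub_apply, ← map_expand T j (hg.bddSnd_comp₂ f v), sub_eq_iff_eq_add] at h₁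
  rw [← e₂, expand_sub j (bddSnd_map T (hf.bddSnd_comp₂ g v)) (hf.bddSnd_comp₂ g (T v)),
    Pi.sub_apply, Pi.sub_apply, ← map_expand T j (hf.bddSnd_comp₂ g v), sub_eq_iff_eq_add] at h₂
  simp only [LinearMap.sub_apply, LinearMap.smul_apply, Module.End.mul_apply,
    fieldProd_apply, bracketExpand, map_sub, map_smul, h₁, h₂]
  push_cast
  module

end FieldProd

/-! ### Signs -/

theorem psign_zero : psign 0 = 1 := by simp [psign]

theorem psign_one : psign 1 = -1 := by simp [psign, ZMod.val_one]

theorem psign_add (p q : ZMod 2) : psign (p + q) = psign p * psign q := by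
  have h : ∀ p : ZMod 2, p = 0 ∨ p = 1 := by decide
  have h2 : (1 + 1 : ZMod 2) = 0 := by decide
  rcases h p with rfl | rfl <;> rcases h q with rfl | rfl <;> simp [psign_zero, psign_one, h2]

theorem psign_mul_self (p : ZMod 2) : psign p * psign p = 1 := by
  rw [← psign_add, CharTwo.add_self_eq_zero, psign_zero]

theorem psign_natCast (n : ℕ) : psign (n : ZMod 2) = (-1) ^ n := by
  induction n with
  | zero => simp [psign_zero]
  | succ n ih => rw [Nat.cast_succ, psign_add, ih, psign_one, pow_succ]

section Sigma

variable {N : ℕ}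

theorem sigma_of_not_disjoint {I J : Finset (Fin N)} (h : ¬Disjoint I J) : sigma I J = 0 := by
  simp [sigma, h]

theorem sigma_mul_self {I J : Finset (Fin N)} (h : Disjoint I J) : sigma I J * sigma I J = 1 := by
  rw [sigma, if_pos h, ← mul_pow]
  simp

theorem sigma_empty_right (I : Finset (Fin N)) : sigma I ∅ = 1 := by simp [sigma]

theorem sigma_union_left {I J : Finset (Fin N)} (h : Disjoint I J) (K : Finset (Fin N)) :
    sigma (I ∪ J) K = sigma I K * sigma J K := by
  by_cases hI : Disjoint I K
  · by_cases hJ : Disjoint J K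
    · rw [sigma, if_pos (Finset.disjoint_union_left.2 ⟨hI, hJ⟩), sigma, if_pos hI, sigma,
        if_pos hJ, ← pow_add, Finset.union_product, Finset.filter_union,
        Finset.card_union_of_disjoint]
      refine Finset.disjoint_filter_filter ?_
      rw [Finset.disjoint_product]
      exact Or.inl h
    · rw [sigma_of_not_disjoint hJ, mul_zero, sigma_of_not_disjoint]
      exact fun h => hJ (Finset.disjoint_union_left.1 h).2
  · rw [sigma_of_not_disjoint hI, zero_mul, sigma_of_not_disjoint]
    exact fun h => hI (Finset.disjoint_union_left.1 h).1

/-- By disjointness every pair in `I × J` is an inversion for exactly one of the two orders, so the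
two inversion counts add up to `|I| |J|`. -/
theorem sigma_comm {I J : Finset (Fin N)} (h : Disjoint I J) :
    sigma I J = (-1) ^ (I.card * J.card) * sigma J I := by
  rw [sigma, if_pos h, sigma, if_pos h.symm]
  have h₁ : ((J ×ˢ I).filter fun x => x.2 < x.1).card =
      ((I ×ˢ J).filter fun x => ¬x.2 < x.1).card := by
    refine Finset.card_bij (fun x _ => (x.2, x.1)) ?_ ?_ ?_
    · rintro ⟨x, y⟩ hxy
      simp only [Finset.mem_filter, Finset.mem_product] at hxy ⊢
      exact ⟨⟨hxy.1.2, hxy.1.1⟩, not_lt.2 hxy.2.le⟩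
    · rintro ⟨x, y⟩ _ ⟨x', y'⟩ _ hxy
      simp only [Prod.mk.injEq] at hxy ⊢
      exact ⟨hxy.2, hxy.1⟩
    · rintro ⟨x, y⟩ hxy
      simp only [Finset.mem_filter, Finset.mem_product] at hxy
      refine ⟨(y, x), ?_, rfl⟩
      simp only [Finset.mem_filter, Finset.mem_product]
      refine ⟨⟨hxy.1.2, hxy.1.1⟩, lt_of_le_of_ne (not_lt.1 hxy.2) ?_⟩
      exact fun he => Finset.disjoint_left.1 h hxy.1.1 (he ▸ hxy.1.2)
  rw [h₁, ← Finset.card_product, ← Finset.card_filter_add_card_filter_not (s := I ×ˢ J)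
    (fun x => x.2 < x.1), pow_add, mul_assoc, ← mul_pow]
  simp

theorem sigma_union_right (I : Finset (Fin N)) {J K : Finset (Fin N)} (h : Disjoint J K) :
    sigma I (J ∪ K) = sigma I J * sigma I K := by
  by_cases hJ : Disjoint I J
  · by_cases hK : Disjoint I K
    · rw [sigma_comm (Finset.disjoint_union_right.2 ⟨hJ, hK⟩), sigma_union_left h, sigma_comm hJ,
        sigma_comm hK, Finset.card_union_of_disjoint h, mul_add, pow_add]
      ring
    · rw [sigma_of_not_disjoint hK, mul_zero, sigma_of_not_disjoint]
      exact fun h => hK (Finset.disjoint_union_right.1 h).2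
  · rw [sigma_of_not_disjoint hJ, zero_mul, sigma_of_not_disjoint]
    exact fun h => hJ (Finset.disjoint_union_right.1 h).1

theorem sigma_insert_left {i : Fin N} {I : Finset (Fin N)} (h : i ∉ I) (K : Finset (Fin N)) :
    sigma (insert i I) K = sigma {i} K * sigma I K := by
  rw [Finset.insert_eq, sigma_union_left (Finset.disjoint_singleton_left.2 h)]

theorem sigma_insert_right (K : Finset (Fin N)) {i : Fin N} {I : Finset (Fin N)} (h : i ∉ I) :
    sigma K (insert i I) = sigma K {i} * sigma K I := by
  rw [Finset.insert_eq, sigma_union_right _ (Finset.disjoint_singleton_left.2 h)]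

theorem sigma_singleton_right {i : Fin N} {I : Finset (Fin N)} (h : i ∉ I) :
    sigma I {i} = psign I.card * sigma {i} I := by
  rw [sigma_comm (Finset.disjoint_singleton_right.2 h), psign_natCast, Finset.card_singleton,
    mul_one]

theorem sigma_singleton_of_mem {i : Fin N} {I : Finset (Fin N)} (h : i ∈ I) : sigma {i} I = 0 :=
  sigma_of_not_disjoint fun hd => Finset.disjoint_singleton_left.1 hd h

theorem sigma_singleton_mul_self {i : Fin N} {I : Finset (Fin N)} (h : i ∉ I) :
    sigma {i} I * sigma {i} I = 1 :=
  sigma_mul_self (Finset.disjoint_singleton_left.2 h)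

/-- The parities of the components that contribute to a component of a product. -/
theorem card_compl_sdiff_add_card_sdiff {J L M : Finset (Fin N)} (hJ : L ⊆ J) (hM : L ⊆ M) :
    ((J \ L)ᶜ.card : ZMod 2) + ((M \ L).card : ZMod 2) = N - J.card + M.card := by
  have h₁ : (J \ L)ᶜ.card + (J \ L).card = N := by
    rw [Finset.card_compl_add_card, Fintype.card_fin]
  have h₂ := Finset.card_sdiff_add_card_eq_card hJ
  have h₃ := Finset.card_sdiff_add_card_eq_card hM
  have e₁ := congr_arg (Nat.cast : ℕ → ZMod 2) h₁
  rw [← h₂, ← h₃]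
  push_cast at e₁ ⊢
  linear_combination e₁

end Sigma

/-! ### Components of products of superfields -/

section Components

variable {N : ℕ} {V : Type*} [AddCommGroup V] [Module ℂ V]

/-- The component of `θ^I` in `a(Z)`, a distribution in `z`. -/
def component {U : Type*} (a : Dist N U) (I : Finset (Fin N)) : ℤ → U := fun n => a n I

theorem component_isField (a : SuperField N V) (I : Finset (Fin N)) :
    IsField (component a.1 I) := fun v => by
  obtain ⟨n₀, h⟩ := a.2 v
  exact ⟨n₀, fun n hn => h n hn I⟩

/-- The sign with which the products of the components `θ^{(J∖L)ᶜ}` and `θ^{M∖L}` contribute to the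
component `θ^M` of a `(j|J)`-product. -/
noncomputable def prodSign (p : ZMod 2) (J L M : Finset (Fin N)) : ℂ :=
  psign (L.card * (J \ L)ᶜ.card) * sigma (J \ L) (J \ L)ᶜ * sigma L (M \ L) *
    (psign L.card * sigma (J \ L) L) * psign ((p + (J \ L)ᶜ.card) * (M \ L).card)

/-- Expanding the odd factor chooses `θ^i` or `-ζ^i` for each `i ∈ J`, so `K` is forced to be `J \
L`. -/
theorem sum_oddCoeff (J M : Finset (Fin N)) (F : Finset (Fin N) → Finset (Fin N) → V) :
    ∑ K : Finset (Fin N), ∑ L ∈ M.powerset, oddCoeff J K L • F K L =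
      ∑ L ∈ (J ∩ M).powerset, (psign L.card * sigma (J \ L) L) • F (J \ L) L := by
  rw [Finset.sum_comm]
  symm
  refine Finset.sum_subset_zero_on_sdiff (Finset.powerset_mono.2 Finset.inter_subset_right) ?_ ?_
  · intro L hL
    simp only [Finset.mem_sdiff, Finset.mem_powerset, Finset.subset_inter_iff, not_and'] at hL
    refine Finset.sum_eq_zero fun K _ => ?_
    rw [oddCoeff, if_neg, zero_smul]
    rintro rfl
    exact hL.2 hL.1 Finset.subset_union_right
  · intro L hL
    simp only [Finset.mem_powerset, Finset.subset_inter_iff] at hL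
    rw [Finset.sum_eq_single (J \ L)]
    · rw [oddCoeff, if_pos (Finset.sdiff_union_of_subset hL.1), psign_natCast]
    · intro K _ hK
      rw [oddCoeff]
      split_ifs with h
      · rw [sigma_of_not_disjoint, mul_zero, zero_smul]
        intro hd
        apply hK
        rw [← h, Finset.union_sdiff_cancel_right hd]
      · rw [zero_smul]
    · simp

theorem finsum_eq_finsum_nat {V : Type*} [AddCommGroup V] {F : ℤ × ℤ → V} (e : ℕ → ℤ × ℤ) (he : Function.Injective e)
    (h : ∀ x, F x ≠ 0 → x ∈ Set.range e) : ∑ᶠ x, F x = ∑ᶠ l : ℕ, F (e l) := by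
  rw [← finsum_mem_range he, finsum_mem_def]
  refine finsum_congr fun x => ?_
  by_cases hx : F x = 0
  · rw [hx]; simp [Set.indicator, hx]
  · rw [Set.indicator_of_mem (h x hx)]

theorem resMul_expZW (p : ZMod 2) (a b : SuperField N V) (j : ℤ) (J : Finset (Fin N)) (m : ℤ)
    (M : Finset (Fin N)) (v : V) :
    resMul (expZW j J) (mulZW p a.1 b.1) m M v = ∑ L ∈ (J ∩ M).powerset, prodSign p J L M •
      expand j (comp₂ (component a.1 (J \ L)ᶜ) (component b.1 (M \ L)) v) (-1) m := by
  let F : Finset (Fin N) → Finset (Fin N) → ℤ × ℤ → V := fun K L kl =>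
    (psign (L.card * Kᶜ.card) * sigma K Kᶜ * sigma L (M \ L) * expZW j J kl.1 K kl.2 L) •
      mulZW p a.1 b.1 (-1 - kl.1) Kᶜ (m - kl.2) (M \ L) v
  let G : Finset (Fin N) → Finset (Fin N) → V := fun K L =>
    (psign (L.card * Kᶜ.card) * sigma K Kᶜ * sigma L (M \ L) *
      psign ((p + Kᶜ.card) * (M \ L).card)) •
        expand j (comp₂ (component a.1 Kᶜ) (component b.1 (M \ L)) v) (-1) m
  have hne : ∀ K L kl, F K L kl ≠ 0 → 0 ≤ kl.2 ∧ kl.1 + kl.2 = j := by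
    intro K L kl h
    by_contra hc
    exact h (by simp [F, expZW, hc])
  have hfin : ∀ K L, (Function.support (F K L)).Finite := by
    intro K L
    obtain ⟨n₀, h₀⟩ := b.2 v
    refine ((Set.finite_Icc 0 (m - n₀)).image fun l => (j - l, l)).subset ?_
    rintro ⟨k, l⟩ hkl
    obtain ⟨h₁, h₂⟩ := hne K L _ hkl
    simp only at h₁ h₂
    refine ⟨l, ⟨h₁, ?_⟩, by ext <;> simp; omega⟩
    by_contra hl
    exact hkl (by simp [F, mulZW, h₀ (m - l) (by omega)])
  have hsum : ∀ K L, ∑ᶠ kl, F K L kl = oddCoeff J K L • G K L := by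
    intro K L
    rw [finsum_eq_finsum_nat (fun l : ℕ => (j - l, (l : ℤ)))
      (fun x y h => by simpa using congr_arg Prod.snd h)
      (fun x hx => ⟨x.2.toNat, by
        obtain ⟨h₁, h₂⟩ := hne K L x hx
        ext <;> simp <;> omega⟩)]
    simp only [G, expand]
    rw [smul_smul, smul_finsum]
    refine finsum_congr fun l => ?_
    simp only [F, expZW, mulZW, comp₂, component, LinearMap.smul_apply, Module.End.mul_apply,
      smul_smul]
    rw [if_pos ⟨by positivity, by ring⟩, zpow_natCast, Int.toNat_natCast]
    congr 1
    ring
  have : resMul (expZW j J) (mulZW p a.1 b.1) m M v =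
      ∑ᶠ kl, ∑ K : Finset (Fin N), ∑ L ∈ M.powerset, F K L kl := rfl
  rw [this, finsum_sum_comm]
  · rw [Finset.sum_congr rfl fun K _ => finsum_sum_comm M.powerset (fun kl L => F K L kl)
      fun L _ => hfin K L]
    simp only [hsum]
    rw [sum_oddCoeff]
    refine Finset.sum_congr rfl fun L _ => ?_
    simp only [G, smul_smul, prodSign]
    congr 1
    ring
  · intro K _
    refine (Set.Finite.biUnion (Finset.finite_toSet M.powerset) fun L _ => hfin K L).subset ?_
    exact Finset.support_sum _ _

theorem resMul_expWZ (p q : ZMod 2) (a b : SuperField N V) (j : ℤ) (J : Finset (Fin N)) (m : ℤ)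
    (M : Finset (Fin N)) (v : V) :
    psign (p * q) • resMul (expWZ j J) (mulWZ q a.1 b.1) m M v =
      ∑ L ∈ (J ∩ M).powerset, prodSign p J L M •
        (psign ((p + (J \ L)ᶜ.card) * (q + (M \ L).card)) * (-1) ^ j) •
          expand j (comp₂ (component b.1 (M \ L)) (component a.1 (J \ L)ᶜ) v) m (-1) := by
  let F : Finset (Fin N) → Finset (Fin N) → ℤ × ℤ → V := fun K L kl =>
    (psign (L.card * Kᶜ.card) * sigma K Kᶜ * sigma L (M \ L) * expWZ j J kl.1 K kl.2 L) •
      mulWZ q a.1 b.1 (-1 - kl.1) Kᶜ (m - kl.2) (M \ L) v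
  let G : Finset (Fin N) → Finset (Fin N) → V := fun K L =>
    (psign (L.card * Kᶜ.card) * sigma K Kᶜ * sigma L (M \ L) * psign (Kᶜ.card * q)) •
      (-1 : ℂ) ^ j • expand j (comp₂ (component b.1 (M \ L)) (component a.1 Kᶜ) v) m (-1)
  have hne : ∀ K L kl, F K L kl ≠ 0 → 0 ≤ kl.1 ∧ kl.1 + kl.2 = j := by
    intro K L kl h
    by_contra hc
    exact h (by simp [F, expWZ, hc])
  have hfin : ∀ K L, (Function.support (F K L)).Finite := by
    intro K L
    obtain ⟨n₀, h₀⟩ := a.2 v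
    refine ((Set.finite_Icc 0 (-1 - n₀)).image fun k => (k, j - k)).subset ?_
    rintro ⟨k, l⟩ hkl
    obtain ⟨h₁, h₂⟩ := hne K L _ hkl
    simp only at h₁ h₂
    refine ⟨k, ⟨h₁, ?_⟩, by ext <;> simp; omega⟩
    by_contra hl
    exact hkl (by simp [F, mulWZ, h₀ (-1 - k) (by omega)])
  have hsum : ∀ K L, ∑ᶠ kl, F K L kl = oddCoeff J K L • G K L := by
    intro K L
    rw [finsum_eq_finsum_nat (fun k : ℕ => ((k : ℤ), j - k))
      (fun x y h => by simpa using congr_arg Prod.fst h)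
      (fun x hx => ⟨x.1.toNat, by
        obtain ⟨h₁, h₂⟩ := hne K L x hx
        ext <;> simp <;> omega⟩)]
    simp only [G, expand]
    rw [smul_smul, smul_smul, smul_finsum]
    refine finsum_congr fun l => ?_
    simp only [F, expWZ, mulWZ, comp₂, component, LinearMap.smul_apply, Module.End.mul_apply,
      smul_smul]
    -- The exponent of `-1` in `expWZ` is that of `w`, here `j - l`; it splits into `(-1)^j` and the
    -- alternating sign built into `expand`.
    rw [if_pos ⟨by positivity, by ring⟩, zpow_sub₀ (by norm_num), zpow_natCast, Int.toNat_natCast,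
      div_eq_mul_inv, ← inv_pow, inv_neg_one]
    congr 1
    ring
  have : resMul (expWZ j J) (mulWZ q a.1 b.1) m M v =
      ∑ᶠ kl, ∑ K : Finset (Fin N), ∑ L ∈ M.powerset, F K L kl := rfl
  rw [this, finsum_sum_comm]
  · rw [Finset.sum_congr rfl fun K _ => finsum_sum_comm M.powerset (fun kl L => F K L kl)
      fun L _ => hfin K L]
    simp only [hsum]
    rw [sum_oddCoeff, Finset.smul_sum]
    refine Finset.sum_congr rfl fun L _ => ?_
    simp only [G, smul_smul, prodSign, mul_add, add_mul, psign_add]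
    congr 1
    linear_combination (-psign (p * q) * psign (L.card * (J \ L)ᶜ.card) *
      sigma (J \ L) (J \ L)ᶜ * sigma L (M \ L) * psign ((J \ L)ᶜ.card * q) * (-1) ^ j *
      (psign L.card * sigma (J \ L) L)) *
      (psign_mul_self (p * (M \ L).card) + psign (p * (M \ L).card) * psign (p * (M \ L).card) *
        psign_mul_self ((J \ L)ᶜ.card * (M \ L).card))
  · intro K _
    refine (Set.Finite.biUnion (Finset.finite_toSet M.powerset) fun L _ => hfin K L).subset ?_
    exact Finset.support_sum _ _

/-- This reduces superfields to fields in one even variable: each `ε` is the sign for exchanging the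
two components according to their own parities. -/
theorem prod_apply (p q : ZMod 2) (a b : SuperField N V) (j : ℤ) (J : Finset (Fin N)) (m : ℤ)
    (M : Finset (Fin N)) :
    (prod p q a b j J).1 m M = ∑ L ∈ (J ∩ M).powerset, prodSign p J L M •
      fieldProd (psign ((p + (J \ L)ᶜ.card) * (q + (M \ L).card))) j
        (component_isField a (J \ L)ᶜ) (component_isField b (M \ L)) m := by
  ext v
  have : (prod p q a b j J).1 m M v = resMul (expZW j J) (mulZW p a.1 b.1) m M v -
    psign (p * q) • resMul (expWZ j J) (mulWZ q a.1 b.1) m M v := rfl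
  rw [this, resMul_expZW, resMul_expWZ, ← Finset.sum_sub_distrib, LinearMap.sum_apply]
  refine Finset.sum_congr rfl fun L _ => ?_
  rw [LinearMap.smul_apply, fieldProd_apply, bracketExpand, smul_sub]

end Components

/-! ### Compatibility of the product signs with the odd derivatives -/

section Leibniz

variable {N : ℕ} {V : Type*} [AddCommGroup V] [Module ℂ V]

/-- The sign comparison when `∂_{θ^i}` falls on the second factor: `L` is kept and `i` joins `M \
L`. -/
theorem prodSign_insert_right (p : ZMod 2) {i : Fin N} {J L M : Finset (Fin N)} (hM : L ⊆ M)
    (hi : i ∉ M) :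
    prodSign p J L M * (psign (p + (J \ L)ᶜ.card) * (psign (M \ L).card * sigma {i} (M \ L))) =
      psign M.card * sigma {i} M * prodSign p J L (insert i M) := by
  have hL : i ∉ L := fun h => hi (hM h)
  have hi' : i ∉ M \ L := fun h => hi (Finset.mem_sdiff.1 h).1
  obtain ⟨M', rfl, hd⟩ : ∃ M', M = L ∪ M' ∧ Disjoint L M' :=
    ⟨M \ L, (Finset.union_sdiff_of_subset hM).symm, Finset.disjoint_sdiff⟩
  have h₁ : (L ∪ M') \ L = M' := Finset.union_sdiff_cancel_left hd
  have h₂ : insert i (L ∪ M') \ L = insert i M' := by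
    rw [Finset.insert_sdiff_of_notMem _ hL, h₁]
  rw [h₁] at hi' ⊢
  simp only [prodSign, h₁, h₂, sigma_insert_right L hi', sigma_singleton_right hL,
    sigma_union_right _ hd, Finset.card_insert_of_notMem hi', Finset.card_union_of_disjoint hd,
    Nat.cast_add, Nat.cast_one, mul_add, mul_one, psign_add]
  set C := psign (L.card * (J \ L)ᶜ.card) * sigma (J \ L) (J \ L)ᶜ * sigma L M' *
    (psign L.card * sigma (J \ L) L) * psign ((p + (J \ L)ᶜ.card) * M'.card) *
    (psign p * psign (J \ L)ᶜ.card) * psign M'.card * sigma {i} M' with hC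
  linear_combination (-C) * psign_mul_self L.card -
    C * psign L.card * psign L.card * sigma_singleton_mul_self hL

/-- The sign comparison when `∂_{θ^i}` falls on the first factor: `i` joins `(J \ L)ᶜ`, which
amounts to adding it to `L`. -/
theorem prodSign_insert_insert (p : ZMod 2) {i : Fin N} {J L M : Finset (Fin N)} (hJ : i ∈ J)
    (hM : L ⊆ M) (hi : i ∉ M) :
    prodSign p J L M * (psign (J \ L)ᶜ.card * sigma {i} (J \ L)ᶜ) =
      psign M.card * sigma {i} M * prodSign p J (insert i L) (insert i M) := by
  have hL : i ∉ L := fun h => hi (hM h)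
  have hi' : i ∉ M \ L := fun h => hi (Finset.mem_sdiff.1 h).1
  obtain ⟨M', rfl, hd⟩ : ∃ M', M = L ∪ M' ∧ Disjoint L M' :=
    ⟨M \ L, (Finset.union_sdiff_of_subset hM).symm, Finset.disjoint_sdiff⟩
  have h₁ : (L ∪ M') \ L = M' := Finset.union_sdiff_cancel_left hd
  have h₂ : insert i (L ∪ M') \ insert i L = M' := by
    rw [Finset.insert_sdiff_insert, Finset.sdiff_insert_of_notMem hi, h₁]
  obtain ⟨K, hK⟩ : ∃ K, J \ insert i L = K := ⟨_, rfl⟩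
  have hiK : i ∉ K := by simp [← hK]
  have hKL : J \ L = insert i K := by
    rw [← hK]
    ext x
    simp only [Finset.mem_sdiff, Finset.mem_insert]
    by_cases hx : x = i
    · subst hx; simp [hJ, hL]
    · simp [hx]
  have hKc : Kᶜ = insert i (insert i K)ᶜ := by
    ext x
    simp only [Finset.mem_compl, Finset.mem_insert]
    by_cases hx : x = i
    · subst hx; simp [hiK]
    · simp [hx]
  obtain ⟨I, hI⟩ : ∃ I, (insert i K)ᶜ = I := ⟨_, rfl⟩
  have hiI : i ∉ I := by simp [← hI]
  rw [h₁] at hi'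
  simp only [prodSign, h₁, h₂, hK, hKL]
  rw [hKc]
  simp only [hI, sigma_insert_left hiK, sigma_insert_left hL, sigma_insert_right K hiI,
    sigma_insert_right K hL, sigma_union_right _ hd, Finset.card_insert_of_notMem hL,
    Finset.card_insert_of_notMem hiI, Finset.card_union_of_disjoint hd,
    Nat.cast_add, Nat.cast_one, mul_add, add_mul, mul_one, one_mul, psign_add, psign_one]
  have hy : sigma K {i} * sigma K {i} = 1 :=
    sigma_mul_self (Finset.disjoint_singleton_right.2 hiK)
  set C := psign (L.card * I.card) * sigma K I * sigma L M' * psign L.card * sigma {i} L *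
    sigma K L * psign (p * M'.card) * psign (I.card * M'.card) * psign I.card with hC
  linear_combination C * sigma_singleton_mul_self hiI - C * psign_mul_self M'.card -
    C * psign M'.card * psign M'.card * sigma_singleton_mul_self hi' -
    C * psign M'.card * psign M'.card * sigma {i} M' * sigma {i} M' * hy -
    C * psign M'.card * psign M'.card * sigma {i} M' * sigma {i} M' * sigma K {i} * sigma K {i} *
      psign_mul_self L.card

theorem compl_sdiff_insert {i : Fin N} {J L : Finset (Fin N)} :
    (J \ insert i L)ᶜ = insert i (J \ L)ᶜ := by
  ext x
  simp only [Finset.mem_compl, Finset.mem_sdiff, Finset.mem_insert]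
  tauto

/-- The signs `prodSign` are compatible with the Leibniz rule for `∂_{θ^i}`. -/
theorem sum_prodSign_leibniz (p : ZMod 2) (i : Fin N) (J M : Finset (Fin N))
    (G : Finset (Fin N) → Finset (Fin N) → V) :
    ∑ L ∈ (J ∩ M).powerset, prodSign p J L M •
      ((psign (J \ L)ᶜ.card * sigma {i} (J \ L)ᶜ) • G (insert i (J \ L)ᶜ) (M \ L) +
        (psign (p + (J \ L)ᶜ.card) * (psign (M \ L).card * sigma {i} (M \ L))) •
          G (J \ L)ᶜ (insert i (M \ L))) =
      (psign M.card * sigma {i} M) • ∑ L ∈ (J ∩ insert i M).powerset,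
        prodSign p J L (insert i M) • G (J \ L)ᶜ (insert i M \ L) := by
  have hsub : ∀ {L M : Finset (Fin N)}, L ∈ (J ∩ M).powerset → L ⊆ J ∧ L ⊆ M := fun h =>
    Finset.subset_inter_iff.1 (Finset.mem_powerset.1 h)
  by_cases hM : i ∈ M
  · rw [sigma_singleton_of_mem hM, mul_zero, zero_smul]
    by_cases hJ : i ∈ J
    · obtain ⟨M, hiM, rfl⟩ : ∃ M', i ∉ M' ∧ M = insert i M' :=
        ⟨M.erase i, Finset.notMem_erase i M, (Finset.insert_erase hM).symm⟩
      -- The terms of `L` and `insert i L` involve the same value of `G`, once from each factor of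
      -- the Leibniz rule, and cancel.
      rw [Finset.inter_insert_of_mem hJ, Finset.sum_powerset_insert (by simp [hiM]),
        ← Finset.sum_add_distrib]
      refine Finset.sum_eq_zero fun L hL => ?_
      obtain ⟨hLJ, hLM⟩ := hsub hL
      have hiL : i ∉ L := fun h => hiM (hLM h)
      have h₁ : insert i M \ L = insert i (M \ L) := Finset.insert_sdiff_of_notMem _ hiL
      have h₂ : insert i M \ insert i L = M \ L := by
        rw [Finset.insert_sdiff_insert, Finset.sdiff_insert_of_notMem hiM]
      have hiI : i ∉ (J \ L)ᶜ := by simp [hJ, hiL]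
      have e₁ := prodSign_insert_right p (J := J) hLM hiM
      have e₂ := prodSign_insert_insert p hJ hLM hiM
      have hu := psign_mul_self M.card
      have hu' := sigma_singleton_mul_self hiM
      rw [compl_sdiff_insert, h₁, h₂, sigma_singleton_of_mem (Finset.mem_insert_self _ _),
        sigma_singleton_of_mem (Finset.mem_insert_self _ _), mul_zero, mul_zero, mul_zero,
        zero_smul, zero_smul, add_zero, zero_add, smul_smul, smul_smul, ← add_smul,
        Finset.card_insert_of_notMem hiI]
      convert zero_smul ℂ _
      -- After multiplication by this unit, `e₁` and `e₂` express both coefficients through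
      -- `prodSign p J L M`; the extra element of `insert i (J \ L)ᶜ` supplies the minus sign.
      have hne : psign M.card * sigma {i} M ≠ 0 := by
        intro h0
        have : (psign M.card * sigma {i} M) * (psign M.card * sigma {i} M) = 1 := by
          linear_combination hu + psign M.card * psign M.card * hu'
        rw [h0, zero_mul] at this
        exact zero_ne_one this
      refine (mul_eq_zero.1 ?_).resolve_left hne
      rw [Nat.cast_succ, ← add_assoc, psign_add (p + _), psign_one]
      linear_combination (-psign (J \ L)ᶜ.card * sigma {i} (J \ L)ᶜ) * e₁ +
        (psign (p + (J \ L)ᶜ.card) * psign (M \ L).card * sigma {i} (M \ L)) * e₂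
    · refine Finset.sum_eq_zero fun L hL => ?_
      obtain ⟨hLJ, hLM⟩ := hsub hL
      rw [sigma_singleton_of_mem (I := (J \ L)ᶜ) (by simp [hJ]),
        sigma_singleton_of_mem (Finset.mem_sdiff.2 ⟨hM, fun h => hJ (hLJ h)⟩)]
      simp
  · rw [Finset.smul_sum]
    have e₃ : ∀ L ∈ (J ∩ M).powerset,
        (psign M.card * sigma {i} M) • prodSign p J L (insert i M) •
          G (J \ L)ᶜ (insert i M \ L) = prodSign p J L M •
        (psign (p + (J \ L)ᶜ.card) * (psign (M \ L).card * sigma {i} (M \ L))) •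
          G (J \ L)ᶜ (insert i (M \ L)) := by
      intro L hL
      rw [smul_smul, smul_smul, prodSign_insert_right p (hsub hL).2 hM,
        Finset.insert_sdiff_of_notMem _ fun h => hM ((hsub hL).2 h)]
    by_cases hJ : i ∈ J
    -- On the right, the subsets without `i` match the derivative of the second factor and those
    -- with `i` the derivative of the first.
    · rw [Finset.inter_insert_of_mem hJ, Finset.sum_powerset_insert (by simp [hM]),
        ← Finset.sum_add_distrib]
      refine Finset.sum_congr rfl fun L hL => ?_
      rw [e₃ L hL, smul_add, add_comm, smul_smul, smul_smul, smul_smul,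
        prodSign_insert_insert p hJ (hsub hL).2 hM, compl_sdiff_insert,
        Finset.insert_sdiff_insert, Finset.sdiff_insert_of_notMem hM]
    · rw [Finset.inter_insert_of_notMem hJ]
      refine Finset.sum_congr rfl fun L hL => ?_
      rw [e₃ L hL, sigma_singleton_of_mem (I := (J \ L)ᶜ) (by simp [hJ])]
      simp

end Leibniz

section SuperFields

variable {N : ℕ} {V : Type*} [AddCommGroup V] [Module ℂ V]

/-! ### Locality of products -/

theorem mulZsubW_iterate (n : ℕ) (u : Dist₂ N (Module.End ℂ V)) (I K : Finset (Fin N)) :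
    (fun k m => mulZsubW^[n] u k I m K) =
      (subMul (Module.End ℂ V) ^ n) fun k m => u k I m K := by
  induction n with
  | zero => simp
  | succ n ih =>
    rw [pow_succ', Module.End.mul_apply, ← ih, Function.iterate_succ_apply']
    rfl

/-- Each component of the super bracket is an ordinary bracket up to a sign. -/
theorem isLocal_iff {p q : ZMod 2} {a b : Dist N (Module.End ℂ V)} :
    IsLocal p q a b ↔ ∀ I K : Finset (Fin N),
      EpsLocal (psign ((p + I.card) * (q + K.card))) (component a I) (component b K) := by
  have hbr : ∀ I K : Finset (Fin N), (fun k m => superBracket p q a b k I m K) =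
      psign ((p + I.card) * K.card) • epsBracket (psign ((p + I.card) * (q + K.card)))
        (component a I) (component b K) := by
    intro I K
    ext1 n; ext1 m
    simp only [superBracket, mulZW, mulWZ, epsBracket, component, Pi.sub_apply, Pi.smul_apply,
      smul_sub, smul_smul, mul_add, add_mul, psign_add]
    congr 2
    linear_combination (-psign (p * q) * psign (I.card * q)) *
      (psign_mul_self (p * K.card) + psign (p * K.card) * psign (p * K.card) *
        psign_mul_self (I.card * K.card))
  have hne : ∀ x : ZMod 2, psign x ≠ 0 := fun x h => by
    have := psign_mul_self x
    rw [h, zero_mul] at this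
    exact zero_ne_one this
  constructor
  · rintro ⟨n, hn⟩ I K
    refine ⟨n, ?_⟩
    have := mulZsubW_iterate n (superBracket p q a b) I K
    rw [hn, hbr, map_smul] at this
    exact (smul_eq_zero.1 this.symm).resolve_left (hne _)
  · intro h
    choose n hn using h
    -- There are finitely many components, so the sum of their exponents bounds them all.
    refine ⟨∑ I, ∑ K, n I K, ?_⟩
    ext1 k; ext1 I; ext1 m; ext1 K
    have := mulZsubW_iterate (∑ I, ∑ K, n I K) (superBracket p q a b) I K
    rw [hbr, map_smul, subMul_pow_eq_zero_of_le (hn I K), smul_zero] at this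
    · exact congr_fun (congr_fun this k) m
    · exact (Finset.single_le_sum (f := fun K => n I K) (fun _ _ => Nat.zero_le _)
        (Finset.mem_univ K)).trans (Finset.single_le_sum (f := fun I => ∑ K, n I K)
        (fun _ _ => Nat.zero_le _) (Finset.mem_univ I))

theorem IsLocal.symm {p q : ZMod 2} {a b : Dist N (Module.End ℂ V)} (h : IsLocal p q a b) :
    IsLocal q p b a := by
  rw [isLocal_iff] at h ⊢
  intro I K
  refine (h K I).symm ?_
  rw [mul_comm (q + _ : ZMod 2), psign_mul_self]

theorem EpsLocal.zero_left (ε : ℂ) (h : ℤ → Module.End ℂ V) : EpsLocal ε 0 h := by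
  refine ⟨0, ?_⟩
  ext1 n; ext1 m
  simp [epsBracket]

theorem EpsLocal.add_left {ε : ℂ} {f g h : ℤ → Module.End ℂ V} (hf : EpsLocal ε f h)
    (hg : EpsLocal ε g h) : EpsLocal ε (f + g) h := by
  obtain ⟨r, hr⟩ := hf
  obtain ⟨s, hs⟩ := hg
  have : epsBracket ε (f + g) h = epsBracket ε f h + epsBracket ε g h := by
    ext1 n; ext1 m
    simp only [epsBracket, Pi.add_apply, add_mul, mul_add, smul_add]
    abel
  refine ⟨r + s, ?_⟩
  rw [this, map_add, subMul_pow_eq_zero_of_le hr (by omega),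
    subMul_pow_eq_zero_of_le hs (by omega), add_zero]

theorem EpsLocal.smul_left {ε : ℂ} {f h : ℤ → Module.End ℂ V} (c : ℂ) (hf : EpsLocal ε f h) :
    EpsLocal ε (c • f) h := by
  obtain ⟨r, hr⟩ := hf
  have : epsBracket ε (c • f) h = c • epsBracket ε f h := by
    ext1 n; ext1 m
    simp only [epsBracket, Pi.smul_apply, smul_mul_assoc, mul_smul_comm, smul_sub, smul_comm c]
  exact ⟨r, by rw [this, map_smul, hr, smul_zero]⟩

theorem EpsLocal.sum_left {ι : Type*} {ε : ℂ} (s : Finset ι) {f : ι → ℤ → Module.End ℂ V}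
    {h : ℤ → Module.End ℂ V} (hf : ∀ i ∈ s, EpsLocal ε (f i) h) : EpsLocal ε (∑ i ∈ s, f i) h :=
  Finset.sum_induction f (fun f => EpsLocal ε f h) (fun _ _ => EpsLocal.add_left)
    (EpsLocal.zero_left ε h) hf

theorem IsLocal.zero_left {p q : ZMod 2} {b : Dist N (Module.End ℂ V)} : IsLocal p q 0 b :=
  isLocal_iff.2 fun _ _ => EpsLocal.zero_left _ _

theorem IsLocal.add_left {p q : ZMod 2} {a a' b : Dist N (Module.End ℂ V)} (h : IsLocal p q a b)
    (h' : IsLocal p q a' b) : IsLocal p q (a + a') b :=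
  isLocal_iff.2 fun I K => (isLocal_iff.1 h I K).add_left (isLocal_iff.1 h' I K)

theorem IsLocal.smul_left {p q : ZMod 2} {a b : Dist N (Module.End ℂ V)} (c : ℂ)
    (h : IsLocal p q a b) : IsLocal p q (c • a) b :=
  isLocal_iff.2 fun I K => (isLocal_iff.1 h I K).smul_left c

theorem component_prod (p q : ZMod 2) (a b : SuperField N V) (j : ℤ) (J M : Finset (Fin N)) :
    component (prod p q a b j J).1 M = ∑ L ∈ (J ∩ M).powerset, prodSign p J L M •
      fieldProd (psign ((p + (J \ L)ᶜ.card) * (q + (M \ L).card))) j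
        (component_isField a (J \ L)ᶜ) (component_isField b (M \ L)) := by
  ext1 m
  rw [Finset.sum_apply]
  exact prod_apply p q a b j J m M

theorem parity_prod (p q : ZMod 2) {J L M : Finset (Fin N)} (hL : L ∈ (J ∩ M).powerset) :
    (p + (J \ L)ᶜ.card) + (q + (M \ L).card) = p + N - J.card + q + M.card := by
  obtain ⟨h₁, h₂⟩ := Finset.subset_inter_iff.1 (Finset.mem_powerset.1 hL)
  linear_combination card_compl_sdiff_add_card_sdiff h₁ h₂

/-- Dong's lemma applies to each summand, and `parity_prod` shows that all summands commute with `c`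
up to the same sign. -/
theorem IsLocal.prod {p q r : ZMod 2} {a b c : SuperField N V} (hab : IsLocal p q a.1 b.1)
    (hac : IsLocal p r a.1 c.1) (hbc : IsLocal q r b.1 c.1) (j : ℤ) (J : Finset (Fin N)) :
    IsLocal (p + N - J.card + q) r (prod p q a b j J).1 c.1 := by
  rw [isLocal_iff] at hab hac hbc ⊢
  intro M K
  rw [component_prod]
  refine EpsLocal.sum_left _ fun L hL => EpsLocal.smul_left _ ?_
  rw [← parity_prod p q hL, add_mul, psign_add]
  exact EpsLocal.fieldProd _ _ (hab _ _) (hac _ _) (hbc _ _) j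

/-! ### Parity of products -/

theorem finsum_mem_submodule {ι : Type*} (W : Submodule ℂ V) {F : ι → V} (h : ∀ i, F i ∈ W) :
    ∑ᶠ i, F i ∈ W :=
  finsum_induction (· ∈ W) W.zero_mem (fun _ _ => W.add_mem) h

theorem HasParity.prod {𝒱 : ZMod 2 → Submodule ℂ V} {p q : ZMod 2} {a b : SuperField N V}
    (ha : HasParity 𝒱 p a.1) (hb : HasParity 𝒱 q b.1) (j : ℤ) (J : Finset (Fin N)) :
    HasParity 𝒱 (p + N - J.card + q) (prod p q a b j J).1 := by
  intro m M r v hv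
  rw [prod_apply, LinearMap.sum_apply]
  refine Submodule.sum_mem _ fun L hL => ?_
  rw [LinearMap.smul_apply, fieldProd_apply, bracketExpand, ← parity_prod p q hL]
  refine Submodule.smul_mem _ _ (Submodule.sub_mem _ ?_ (Submodule.smul_mem _ _ ?_))
  · refine finsum_mem_submodule _ fun l => Submodule.smul_mem _ _ ?_
    have := ha (-1 - (j - l)) (J \ L)ᶜ _ _ (hb (m - l) (M \ L) _ _ hv)
    rwa [← add_assoc] at this
  · refine finsum_mem_submodule _ fun l => Submodule.smul_mem _ _ ?_
    have := hb (m - (j - l)) (M \ L) _ _ (ha (-1 - l) (J \ L)ᶜ _ _ hv)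
    rwa [← add_assoc, add_comm (q + _ : ZMod 2)] at this

/-! ### Translation covariance of products -/

theorem opBracket_zero_eq_dz_iff {p : ZMod 2} {T : Module.End ℂ V}
    {a : Dist N (Module.End ℂ V)} : opBracket 0 p T a = dz a ↔
      ∀ n I, T * a n I - a n I * T = ((n : ℂ) + 1) • a (n + 1) I := by
  have h : ∀ n I, dz a n I = ((n : ℂ) + 1) • a (n + 1) I := fun n I => by
    rw [dz, ← Int.cast_smul_eq_zsmul ℂ]
    push_cast
    rfl
  constructor
  · intro ha n I
    rw [← h, ← ha]
    simp [opBracket, psign_zero]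
  · intro ha
    ext1 n; ext1 I
    rw [h, ← ha]
    simp [opBracket, psign_zero]

theorem opBracket_one_eq_dtheta_iff {p : ZMod 2} {S : Module.End ℂ V} {i : Fin N}
    {a : Dist N (Module.End ℂ V)} : opBracket 1 p S a = dtheta i a ↔
      ∀ n I, S * a n I - psign (p + I.card) • (a n I * S) =
        (psign I.card * sigma {i} I) • a n (insert i I) := by
  constructor
  · intro ha n I
    rw [mul_smul]
    change _ = psign I.card • dtheta i a n I
    rw [← ha, opBracket, smul_sub, smul_smul, smul_smul, one_mul, one_mul, psign_mul_self,
      one_smul, psign_add, mul_comm (psign p)]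
  · intro ha
    ext1 n; ext1 I
    have h := congr_arg (psign I.card • ·) (ha n I)
    simp only [smul_smul, smul_sub] at h
    rw [← mul_assoc, psign_mul_self, one_mul] at h
    rw [dtheta, ← h, opBracket, one_mul, one_mul, psign_add]
    congr 2
    linear_combination (-psign p) * psign_mul_self I.card

theorem prod_T_bracket {T : Module.End ℂ V} {p q : ZMod 2} {a b : SuperField N V}
    (ha : opBracket 0 p T a.1 = dz a.1) (hb : opBracket 0 q T b.1 = dz b.1) (r : ZMod 2) (j : ℤ)
    (J : Finset (Fin N)) : opBracket 0 r T (prod p q a b j J).1 = dz (prod p q a b j J).1 := by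
  rw [opBracket_zero_eq_dz_iff] at ha hb ⊢
  intro m M
  rw [prod_apply, prod_apply, Finset.mul_sum, Finset.sum_mul, ← Finset.sum_sub_distrib,
    Finset.smul_sum]
  refine Finset.sum_congr rfl fun L _ => ?_
  rw [mul_smul_comm, smul_mul_assoc, ← smul_sub, smul_comm _ (prodSign _ _ _ _)]
  congr 1
  exact fieldProd_translation _ _ (fun n => ha n _) (fun n => hb n _) _ _ _

theorem IsField.smul {f : ℤ → Module.End ℂ V} (c : ℂ) (hf : IsField f) : IsField (c • f) :=
  fun v => by
    obtain ⟨n₀, h⟩ := hf v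
    exact ⟨n₀, fun n hn => by simp [h n hn]⟩

theorem comp₂_smul_left (c : ℂ) (f g : ℤ → Module.End ℂ V) (v : V) :
    comp₂ (c • f) g v = c • comp₂ f g v := by
  ext n m
  simp [comp₂]

theorem comp₂_smul_right (c : ℂ) (f g : ℤ → Module.End ℂ V) (v : V) :
    comp₂ f (c • g) v = c • comp₂ f g v := by
  ext n m
  simp [comp₂]

theorem fieldProd_smul_left (ε c : ℂ) (j : ℤ) {f g : ℤ → Module.End ℂ V} (hf : IsField f)
    (hg : IsField g) (m : ℤ) :
    fieldProd ε j (hf.smul c) hg m = c • fieldProd ε j hf hg m := by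
  ext v
  simp only [fieldProd_apply, bracketExpand, LinearMap.smul_apply, comp₂_smul_left,
    comp₂_smul_right, expand_smul, Pi.smul_apply]
  module

theorem fieldProd_smul_right (ε c : ℂ) (j : ℤ) {f g : ℤ → Module.End ℂ V} (hf : IsField f)
    (hg : IsField g) (m : ℤ) :
    fieldProd ε j hf (hg.smul c) m = c • fieldProd ε j hf hg m := by
  ext v
  simp only [fieldProd_apply, bracketExpand, LinearMap.smul_apply, comp₂_smul_left,
    comp₂_smul_right, expand_smul, Pi.smul_apply]
  module

theorem prod_S_bracket {S : Module.End ℂ V} {i : Fin N} {p q : ZMod 2} {a b : SuperField N V}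
    (ha : opBracket 1 p S a.1 = dtheta i a.1) (hb : opBracket 1 q S b.1 = dtheta i b.1) (j : ℤ)
    (J : Finset (Fin N)) :
    opBracket 1 (p + N - J.card + q) S (prod p q a b j J).1 = dtheta i (prod p q a b j J).1 := by
  rw [opBracket_one_eq_dtheta_iff] at ha hb ⊢
  intro m M
  have key := sum_prodSign_leibniz p i J M fun I K =>
    fieldProd (psign ((p + I.card) * (q + K.card))) j (component_isField a I)
      (component_isField b K) m
  rw [prod_apply, prod_apply, ← key, Finset.mul_sum, Finset.sum_mul, Finset.smul_sum,
    ← Finset.sum_sub_distrib]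
  refine Finset.sum_congr rfl fun L hL => ?_
  rw [mul_smul_comm, smul_mul_assoc, smul_comm _ (prodSign _ _ _ _), ← smul_sub]
  congr 1
  rw [← parity_prod p q hL, psign_add,
    fieldProd_derivation (component_isField a (J \ L)ᶜ) (component_isField b (M \ L))
      ((component_isField a (insert i (J \ L)ᶜ)).smul _)
      ((component_isField b (insert i (M \ L))).smul _) (psign_mul_self _)
      (fun n => ha n _) (fun n => hb n _), fieldProd_smul_left _ _ _ (component_isField a _),
    fieldProd_smul_right _ _ _ _ (component_isField b _), smul_smul]
  congr 1
  -- The exchange signs agree only when `i` is new to the index set; otherwise the derivative is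
  -- zero and they do not matter.
  · by_cases hi : i ∈ (J \ L)ᶜ
    · rw [sigma_singleton_of_mem hi, mul_zero, zero_smul, zero_smul]
    · rw [Finset.card_insert_of_notMem hi, ← psign_add]
      congr 3
      push_cast
      ring
  · by_cases hi : i ∈ M \ L
    · rw [sigma_singleton_of_mem hi, mul_zero, mul_zero, zero_smul, zero_smul]
    · rw [Finset.card_insert_of_notMem hi, ← psign_add]
      congr 3
      push_cast
      ring

/-! ### Products on the vacuum -/

theorem prod_vac_regular {p q : ZMod 2} {a b : SuperField N V} {v : V}
    (ha : ∀ n < 0, ∀ I, a.1 n I v = 0) (hb : ∀ n < 0, ∀ I, b.1 n I v = 0) (j : ℤ)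
    (J : Finset (Fin N)) (m : ℤ) (hm : m < 0) (M : Finset (Fin N)) :
    (prod p q a b j J).1 m M v = 0 := by
  rw [prod_apply, LinearMap.sum_apply]
  refine Finset.sum_eq_zero fun L _ => ?_
  rw [LinearMap.smul_apply, fieldProd_apply, bracketExpand, expand,
    finsum_eq_zero_of_forall_eq_zero, expand, finsum_eq_zero_of_forall_eq_zero]
  · simp
  · intro l
    simp [comp₂, component, ha (-1 - l) (by omega)]
  · intro l
    simp [comp₂, component, hb (m - l) (by omega)]

/-- At `W = 0` only `L = ∅` occurs. Regularity of `a` on `v` kills the `b a` term, and that of `b`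
leaves only the leading term of the expansion. -/
theorem prod_vac_const {p q : ZMod 2} {a b : SuperField N V} {v : V}
    (ha : ∀ n < 0, ∀ I, a.1 n I v = 0) (hb : ∀ n < 0, ∀ I, b.1 n I v = 0) (j : ℤ)
    (J : Finset (Fin N)) :
    (prod p q a b j J).1 0 ∅ v = sigma J Jᶜ • mode a.1 j J (b.1 0 ∅ v) := by
  rw [prod_apply, Finset.inter_empty, Finset.powerset_empty, Finset.sum_singleton,
    LinearMap.smul_apply, fieldProd_apply, bracketExpand, expand, finsum_eq_single _ 0, expand,
    finsum_eq_zero_of_forall_eq_zero]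
  · simp [comp₂, component, prodSign, psign_zero, sigma_empty_right, mode,
      show -1 - j = -1 + -j by ring]
  · intro l
    simp [comp₂, component, ha (-1 - l) (by omega)]
  · intro l hl
    simp [comp₂, component, hb (-l) (by omega)]

end SuperFields

/-! ### Covariant fields local to the generators -/

section StateFields

variable {N : ℕ} {V : Type*} [AddCommGroup V] [Module ℂ V]

theorem opBracket_add (q p : ZMod 2) (X : Module.End ℂ V) (a b : Dist N (Module.End ℂ V)) :
    opBracket q p X (a + b) = opBracket q p X a + opBracket q p X b := by
  ext1 n; ext1 I
  simp only [opBracket, Pi.add_apply, mul_add, add_mul, smul_add]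
  abel

theorem opBracket_smul (q p : ZMod 2) (X : Module.End ℂ V) (c : ℂ)
    (a : Dist N (Module.End ℂ V)) : opBracket q p X (c • a) = c • opBracket q p X a := by
  ext1 n; ext1 I
  simp only [opBracket, Pi.smul_apply, mul_smul_comm, smul_mul_assoc, smul_sub, smul_comm c]

theorem dz_add {V : Type*} [AddCommGroup V] (a b : Dist N V) : dz (a + b) = dz a + dz b := by
  ext n I
  simp [dz]

theorem dz_smul (c : ℂ) (a : Dist N V) : dz (c • a) = c • dz a := by
  ext n I
  simp only [dz, Pi.smul_apply]
  rw [smul_comm]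

theorem dtheta_add (i : Fin N) (a b : Dist N V) : dtheta i (a + b) = dtheta i a + dtheta i b := by
  ext n I
  simp [dtheta]

theorem dtheta_smul (i : Fin N) (c : ℂ) (a : Dist N V) : dtheta i (c • a) = c • dtheta i a := by
  ext n I
  simp only [dtheta, Pi.smul_apply]
  rw [smul_comm]

variable {A : Type*}

/-- Superfields of parity `p` that are translation covariant, regular on the vacuum and local with
respect to the superfields `a α`. -/
structure IsStateField (𝒱 : ZMod 2 → Submodule ℂ V) (vac : V) (T : Module.End ℂ V)
    (S : Fin N → Module.End ℂ V) (par : A → ZMod 2) (a : A → SuperField N V) (p : ZMod 2)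
    (f : SuperField N V) : Prop where
  hasParity : HasParity 𝒱 p f.1
  regular : ∀ n < 0, ∀ I, f.1 n I vac = 0
  T_bracket : opBracket 0 p T f.1 = dz f.1
  S_bracket : ∀ i, opBracket 1 p (S i) f.1 = dtheta i f.1
  isLocal : ∀ α, IsLocal (par α) p (a α).1 f.1

/-- The superfields satisfying `IsStateField`, as a submodule. -/
def stateFields (𝒱 : ZMod 2 → Submodule ℂ V) (vac : V) (T : Module.End ℂ V)
    (S : Fin N → Module.End ℂ V) (par : A → ZMod 2) (a : A → SuperField N V) (p : ZMod 2) :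
    Submodule ℂ (SuperField N V) where
  carrier := {f | IsStateField 𝒱 vac T S par a p f}
  add_mem' {f g} hf hg :=
    { hasParity := fun n I q v hv =>
        Submodule.add_mem _ (hf.hasParity n I q v hv) (hg.hasParity n I q v hv)
      regular := fun n hn I => by simp [hf.regular n hn I, hg.regular n hn I]
      T_bracket := by
        rw [Submodule.coe_add, opBracket_add, dz_add, hf.T_bracket, hg.T_bracket]
      S_bracket := fun i => by
        rw [Submodule.coe_add, opBracket_add, dtheta_add, hf.S_bracket, hg.S_bracket]
      isLocal := fun α => ((hf.isLocal α).symm.add_left (hg.isLocal α).symm).symm }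
  zero_mem' :=
    { hasParity := fun n I q v hv => Submodule.zero_mem _
      regular := fun n hn I => rfl
      T_bracket := by ext1 n; ext1 I; simp [opBracket, dz]
      S_bracket := fun i => by ext1 n; ext1 I; simp [opBracket, dtheta]
      isLocal := fun α => IsLocal.zero_left.symm }
  smul_mem' c f hf :=
    { hasParity := fun n I q v hv => Submodule.smul_mem _ c (hf.hasParity n I q v hv)
      regular := fun n hn I => by simp [hf.regular n hn I]
      T_bracket := by rw [Submodule.coe_smul, opBracket_smul, dz_smul, hf.T_bracket]
      S_bracket := fun i => by rw [Submodule.coe_smul, opBracket_smul, dtheta_smul, hf.S_bracket]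
      isLocal := fun α => ((hf.isLocal α).symm.smul_left c).symm }

variable {𝒱 : ZMod 2 → Submodule ℂ V} {vac : V} {T : Module.End ℂ V}
  {S : Fin N → Module.End ℂ V} {par : A → ZMod 2} {a : A → SuperField N V}

theorem mem_stateFields {p : ZMod 2} {f : SuperField N V} :
    f ∈ stateFields 𝒱 vac T S par a p ↔ IsStateField 𝒱 vac T S par a p f := Iff.rfl

theorem idField_apply (n : ℤ) (I : Finset (Fin N)) :
    (idField N V).1 n I = if n = 0 ∧ I = ∅ then 1 else 0 := rfl

theorem isLocal_idField (q : ZMod 2) (b : SuperField N V) :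
    IsLocal 0 q (idField N V).1 b.1 := by
  rw [isLocal_iff]
  intro I K
  refine ⟨0, ?_⟩
  ext1 n; ext1 m
  simp only [pow_zero, Module.End.one_apply, epsBracket, component, idField_apply]
  split_ifs with h
  · simp [h.2, psign_zero]
  · simp

theorem isStateField_idField : IsStateField 𝒱 vac T S par a 0 (idField N V) where
  hasParity n I q v hv := by
    rw [idField_apply]
    split_ifs with h
    · simpa [h.2] using hv
    · exact Submodule.zero_mem _
  regular n hn I := by
    rw [idField_apply, if_neg (by omega)]
    rfl
  T_bracket := by
    rw [opBracket_zero_eq_dz_iff]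
    intro n I
    rw [idField_apply, idField_apply]
    have h₁ : ((n : ℂ) + 1) • (if n + 1 = 0 ∧ I = ∅ then (1 : Module.End ℂ V) else 0) = 0 := by
      split_ifs with h
      · have : (n : ℂ) + 1 = 0 := by exact_mod_cast h.1
        rw [this, zero_smul]
      · simp
    rw [h₁]
    split_ifs <;> simp
  S_bracket i := by
    rw [opBracket_one_eq_dtheta_iff]
    intro n I
    rw [idField_apply, idField_apply, if_neg (c := n = 0 ∧ insert i I = ∅) (by simp)]
    split_ifs with h
    · simp [h.2, psign_zero]
    · simp
  isLocal α := (isLocal_idField _ _).symm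

theorem IsStateField.prod {q : ZMod 2} {f : SuperField N V} {α : A}
    (hf : IsStateField 𝒱 vac T S par a q f) (hα : IsStateField 𝒱 vac T S par a (par α) (a α))
    (j : ℤ) (J : Finset (Fin N)) :
    IsStateField 𝒱 vac T S par a (par α + N - J.card + q) (prod (par α) q (a α) f j J) where
  hasParity := hα.hasParity.prod hf.hasParity j J
  regular := prod_vac_regular hα.regular hf.regular j J
  T_bracket := prod_T_bracket hα.T_bracket hf.T_bracket _ j J
  S_bracket i := prod_S_bracket (hα.S_bracket i) (hf.S_bracket i) j J
  isLocal β := (IsLocal.prod (hf.isLocal α) (hα.isLocal β).symm (hf.isLocal β).symm j J).symm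

theorem isStateField_wordField (ha : ∀ α, IsStateField 𝒱 vac T S par a (par α) (a α))
    (w : List (A × ℤ × Finset (Fin N))) :
    IsStateField 𝒱 vac T S par a (wordPar par w) (wordField par a w) := by
  induction w with
  | nil => exact isStateField_idField
  | cons x w ih => exact ih.prod (ha x.1) x.2.1 x.2.2

theorem wordField_vac (ha : ∀ α, IsStateField 𝒱 vac T S par a (par α) (a α))
    (w : List (A × ℤ × Finset (Fin N))) :
    (wordField par a w).1 0 ∅ vac = wordSign w • wordVec a vac w := by
  induction w with
  | nil => simp [wordField, wordSign, wordVec, idField_apply]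
  | cons x w ih =>
    rw [wordField, prod_vac_const (ha x.1).regular (isStateField_wordField ha w).regular, ih,
      map_smul, smul_smul]
    rfl

theorem wordSign_mul_self (w : List (A × ℤ × Finset (Fin N))) : wordSign w * wordSign w = 1 := by
  induction w with
  | nil => simp [wordSign]
  | cons x w ih =>
    have : wordSign (x :: w) = sigma x.2.2 x.2.2ᶜ * wordSign w := by simp [wordSign]
    rw [this]
    linear_combination sigma_mul_self (disjoint_compl_right (a := x.2.2)) +
      sigma x.2.2 x.2.2ᶜ * sigma x.2.2 x.2.2ᶜ * ih

/-- The word vector is, up to a sign, the state of a homogeneous field. -/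
theorem wordVec_mem (hvac : vac ∈ 𝒱 0) (ha : ∀ α, IsStateField 𝒱 vac T S par a (par α) (a α))
    (w : List (A × ℤ × Finset (Fin N))) : wordVec a vac w ∈ 𝒱 (wordPar par w) := by
  have h := (isStateField_wordField ha w).hasParity 0 ∅ 0 vac hvac
  rw [wordField_vac ha, Finset.card_empty, Nat.cast_zero, add_zero, add_zero] at h
  have := Submodule.smul_mem _ (wordSign w) h
  rwa [smul_smul, wordSign_mul_self, one_smul] at this

theorem isLocal_wordField (ha : ∀ α, IsStateField 𝒱 vac T S par a (par α) (a α))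
    (w w' : List (A × ℤ × Finset (Fin N))) :
    IsLocal (wordPar par w) (wordPar par w') (wordField par a w).1 (wordField par a w').1 := by
  induction w with
  | nil => exact isLocal_idField _ _
  | cons x w ih =>
    exact IsLocal.prod ((isStateField_wordField ha w).isLocal x.1)
      ((isStateField_wordField ha w').isLocal x.1) ih x.2.1 x.2.2

/-! ### Goddard uniqueness -/

/-- As `T` and the `S i` kill the vacuum, covariance produces the coefficients of `f(Z)|0⟩` from the
constant one: the `S i` add odd variables, and `T` raises the power of `z` up to a nonzero integer
factor. -/
theorem IsStateField.vac_eq_zero {p : ZMod 2} {f : SuperField N V}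
    (hf : IsStateField 𝒱 vac T S par a p f) (hTvac : T vac = 0) (hSvac : ∀ i, S i vac = 0)
    (h₀ : f.1 0 ∅ vac = 0) (n : ℤ) (I : Finset (Fin N)) : f.1 n I vac = 0 := by
  have hT := opBracket_zero_eq_dz_iff.1 hf.T_bracket
  have hS := fun i => opBracket_one_eq_dtheta_iff.1 (hf.S_bracket i)
  have h₁ : f.1 0 I vac = 0 := by
    induction I using Finset.induction_on with
    | empty => exact h₀
    | insert i I hi ih =>
      have h := LinearMap.congr_fun (hS i 0 I) vac
      simp only [LinearMap.sub_apply, LinearMap.smul_apply, Module.End.mul_apply, ih, hSvac,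
        map_zero, smul_zero, sub_zero] at h
      refine (smul_eq_zero.1 h.symm).resolve_left fun h0 => ?_
      have : (psign I.card * sigma {i} I) * (psign I.card * sigma {i} I) = 1 := by
        linear_combination psign_mul_self I.card +
          psign I.card * psign I.card * sigma_singleton_mul_self hi
      rw [h0, zero_mul] at this
      exact zero_ne_one this
  rcases lt_or_ge n 0 with hn | hn
  · exact hf.regular n hn I
  obtain ⟨k, rfl⟩ := Int.eq_ofNat_of_zero_le hn
  clear hn
  induction k with
  | zero => exact h₁
  | succ k ih =>
    have h := LinearMap.congr_fun (hT k I) vac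
    simp only [LinearMap.sub_apply, LinearMap.smul_apply, Module.End.mul_apply, ih, hTvac,
      map_zero, sub_zero] at h
    refine (smul_eq_zero.1 h.symm).resolve_left ?_
    exact_mod_cast Nat.succ_ne_zero k

/-- Since `f(z) v = 0`, the series `f(z) g(w) v` equals the bracket on `v`. A power of `z - w` kills
it, and it is bounded below in `w`, so it vanishes. -/
theorem EpsLocal.apply_eq_zero {ε : ℂ} {f g : ℤ → Module.End ℂ V} (h : EpsLocal ε f g)
    (hg : IsField g) {v : V} (hv : ∀ n, f n v = 0) (n m : ℤ) : f n (g m v) = 0 := by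
  obtain ⟨k, hk⟩ := h
  have h₁ : comp₂ f g v = fun n m => epsBracket ε f g n m v := by
    ext n m
    simp [comp₂, epsBracket, hv]
  have h₂ : comp₂ f g v = 0 := by
    refine subMul_pow_injective k (hg.bddSnd_comp₂ f v) ?_
    rw [h₁, ← pow_intertwine (P := subMul (Module.End ℂ V))
      (fun (u : ℤ → ℤ → Module.End ℂ V) n m => u n m v) (fun u => by ext n m; simp [subMul_apply]),
      hk]
    rfl
  exact congr_fun (congr_fun h₂ n) m

/-- A state field is determined by its state. -/
theorem IsStateField.eq_zero {p : ZMod 2} {f : SuperField N V}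
    (hf : IsStateField 𝒱 vac T S par a p f) (hTvac : T vac = 0) (hSvac : ∀ i, S i vac = 0)
    (hspan : Submodule.span ℂ (Set.range (wordVec a vac)) = ⊤) (h₀ : f.1 0 ∅ vac = 0) : f = 0 := by
  have hw : ∀ (w : List (A × ℤ × Finset (Fin N))) n I, f.1 n I (wordVec a vac w) = 0 := by
    intro w
    induction w with
    | nil => exact hf.vac_eq_zero hTvac hSvac h₀
    | cons x w ih =>
      intro n I
      exact (isLocal_iff.1 (hf.isLocal x.1).symm I x.2.2ᶜ).apply_eq_zero
        (component_isField (a x.1) _) (fun n => ih n I) n _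
  ext1
  ext1 n; ext1 I
  refine LinearMap.ext_on hspan ?_
  rintro _ ⟨w, rfl⟩
  exact hw w n I

theorem IsStateField.eq_of_vac_eq {p : ZMod 2} {f g : SuperField N V}
    (hf : IsStateField 𝒱 vac T S par a p f) (hg : IsStateField 𝒱 vac T S par a p g)
    (hTvac : T vac = 0) (hSvac : ∀ i, S i vac = 0)
    (hspan : Submodule.span ℂ (Set.range (wordVec a vac)) = ⊤)
    (h₀ : f.1 0 ∅ vac = g.1 0 ∅ vac) : f = g := by
  rw [← sub_eq_zero]
  refine (mem_stateFields.1 (Submodule.sub_mem _ (mem_stateFields.2 hf)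
    (mem_stateFields.2 hg))).eq_zero hTvac hSvac hspan ?_
  simp [h₀]

/-! ### The state-field correspondence -/

variable (par a) in
/-- The span of the iterated products of parity `p`. -/
noncomputable def wordFieldSpan (p : ZMod 2) : Submodule ℂ (SuperField N V) :=
  Submodule.span ℂ {f | ∃ w, wordPar par w = p ∧ wordField par a w = f}

theorem isStateField_of_mem_wordFieldSpan
    (ha : ∀ α, IsStateField 𝒱 vac T S par a (par α) (a α)) {p : ZMod 2} {f : SuperField N V}
    (hf : f ∈ wordFieldSpan par a p) : IsStateField 𝒱 vac T S par a p f := by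
  refine mem_stateFields.1 ((Submodule.span_le.2 ?_) hf)
  rintro _ ⟨w, rfl, rfl⟩
  exact isStateField_wordField ha w

/-- `IsStateField` gives locality only with the generators. Locality among the values of `Y` comes
from the inductive construction of words, so `Y` is built in this span. -/
theorem isLocal_of_mem_wordFieldSpan
    (ha : ∀ α, IsStateField 𝒱 vac T S par a (par α) (a α)) {p q : ZMod 2} {f g : SuperField N V}
    (hf : f ∈ wordFieldSpan par a p) (hg : g ∈ wordFieldSpan par a q) :
    IsLocal p q f.1 g.1 := by
  induction hf using Submodule.span_induction with
  | mem f hf =>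
    obtain ⟨w, rfl, rfl⟩ := hf
    induction hg using Submodule.span_induction with
    | mem g hg =>
      obtain ⟨w', rfl, rfl⟩ := hg
      exact isLocal_wordField ha w w'
    | zero => exact IsLocal.zero_left.symm
    | add g g' _ _ h h' => exact (h.symm.add_left h'.symm).symm
    | smul c g _ h => exact (h.symm.smul_left c).symm
  | zero => exact IsLocal.zero_left
  | add f f' _ _ h h' => exact h.add_left h'
  | smul c f _ h => exact h.smul_left c

variable (N) in
/-- The map `f(Z) ↦ f(Z)|0⟩|_{Z = 0}`. -/
def stateMap (vac : V) : SuperField N V →ₗ[ℂ] V where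
  toFun f := f.1 0 ∅ vac
  map_add' _ _ := rfl
  map_smul' _ _ := rfl

theorem stateMap_apply (f : SuperField N V) : stateMap N vac f = f.1 0 ∅ vac := rfl

theorem stateMap_mem (hvac : vac ∈ 𝒱 0) {p : ZMod 2} {f : SuperField N V}
    (hf : HasParity 𝒱 p f.1) : stateMap N vac f ∈ 𝒱 p := by
  simpa [stateMap_apply] using hf 0 ∅ 0 vac hvac

theorem eq_zero_of_mem_of_mem [DirectSum.Decomposition 𝒱] {p q : ZMod 2} (hpq : p ≠ q) {v : V}
    (hp : v ∈ 𝒱 p) (hq : v ∈ 𝒱 q) : v = 0 := by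
  rw [← DirectSum.decompose_of_mem_same 𝒱 hp, DirectSum.decompose_of_mem_ne 𝒱 hq hpq.symm]

/-- There is a state-field correspondence on `V`, with values in the span of the iterated
products. -/
theorem exists_stateField [DirectSum.Decomposition 𝒱] (hvac : vac ∈ 𝒱 0) (hTvac : T vac = 0)
    (hSvac : ∀ i, S i vac = 0) (ha : ∀ α, IsStateField 𝒱 vac T S par a (par α) (a α))
    (hspan : Submodule.span ℂ (Set.range (wordVec a vac)) = ⊤) :
    ∃ Y : V →ₗ[ℂ] SuperField N V, (∀ v, stateMap N vac (Y v) = v) ∧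
      ∀ p, ∀ v ∈ 𝒱 p, Y v ∈ wordFieldSpan par a p := by
  have hF : ∀ {p f}, f ∈ wordFieldSpan par a p → IsStateField 𝒱 vac T S par a p f :=
    fun h => isStateField_of_mem_wordFieldSpan ha h
  have h2 : ∀ p : ZMod 2, p = 0 ∨ p = 1 := by decide
  let L := wordFieldSpan par a
  let Φ : L 0 × L 1 →ₗ[ℂ] SuperField N V := (L 0).subtype.coprod (L 1).subtype
  let Ψ : L 0 × L 1 →ₗ[ℂ] V := stateMap N vac ∘ₗ Φ
  have hΨ : ∀ x, Ψ x = stateMap N vac x.1.1 + stateMap N vac x.2.1 := fun x => by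
    simp [Ψ, Φ]
  have hzero : ∀ {p} (f : L p), stateMap N vac f.1 = 0 → f = 0 := fun f hf =>
    Subtype.ext ((hF f.2).eq_zero hTvac hSvac hspan hf)
  have hmem : ∀ {p} (f : L p), stateMap N vac f.1 ∈ 𝒱 p := fun f =>
    stateMap_mem hvac (hF f.2).hasParity
  -- An even total state forces the odd summand's state into `𝒱 0 ⊓ 𝒱 1`, hence to be zero, and
  -- Goddard uniqueness kills that summand. Together with `hΨ₁` this gives injectivity and shows
  -- that `Y` respects parity.
  have hΨ₀ : ∀ x, Ψ x ∈ 𝒱 0 → x.2 = 0 := fun x hx => by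
    refine hzero _ (eq_zero_of_mem_of_mem (𝒱 := 𝒱) zero_ne_one ?_ (hmem x.2))
    rw [hΨ] at hx
    simpa using Submodule.sub_mem _ hx (hmem x.1)
  have hΨ₁ : ∀ x, Ψ x ∈ 𝒱 1 → x.1 = 0 := fun x hx => by
    refine hzero _ (eq_zero_of_mem_of_mem (𝒱 := 𝒱) zero_ne_one (hmem x.1) ?_)
    rw [hΨ] at hx
    simpa using Submodule.sub_mem _ hx (hmem x.2)
  have hinj : Function.Injective Ψ := by
    rw [injective_iff_map_eq_zero]
    intro x hx
    exact Prod.ext (hΨ₁ x (hx ▸ Submodule.zero_mem _)) (hΨ₀ x (hx ▸ Submodule.zero_mem _))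
  have hsurj : Function.Surjective Ψ := by
    rw [← LinearMap.range_eq_top, ← top_le_iff, ← hspan, Submodule.span_le]
    rintro _ ⟨w, rfl⟩
    have hw : stateMap N vac (wordSign w • wordField par a w) = wordVec a vac w := by
      rw [map_smul, stateMap_apply, wordField_vac ha, smul_smul, wordSign_mul_self, one_smul]
    have hwL : wordSign w • wordField par a w ∈ L (wordPar par w) :=
      Submodule.smul_mem _ _ (Submodule.subset_span ⟨w, rfl, rfl⟩)
    rcases h2 (wordPar par w) with h | h <;> rw [h] at hwL
    · exact ⟨(⟨_, hwL⟩, 0), by rw [hΨ]; simpa using hw⟩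
    · exact ⟨(0, ⟨_, hwL⟩), by rw [hΨ]; simpa using hw⟩
  let e := LinearEquiv.ofBijective Ψ ⟨hinj, hsurj⟩
  have he : ∀ v, Ψ (e.symm v) = v := fun v => e.apply_symm_apply v
  refine ⟨Φ ∘ₗ e.symm.toLinearMap, he, fun p v hv => ?_⟩
  have hv' := hv
  rw [← he v] at hv'
  have hΦ : (Φ ∘ₗ e.symm.toLinearMap) v = (e.symm v).1.1 + (e.symm v).2.1 := by simp [Φ]
  rw [hΦ]
  rcases h2 p with rfl | rfl
  · rw [hΨ₀ _ hv']
    simp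
  · rw [hΨ₁ _ hv']
    simp

end StateFields

end SUSY

/-! ### Existence and uniqueness of the SUSY vertex algebra -/

open SUSY in
theorem mainTheorem1 (N : ℕ) {V : Type*} [AddCommGroup V] [Module ℂ V]
    (𝒱 : ZMod 2 → Submodule ℂ V) [DirectSum.Decomposition 𝒱]
    (vac : V) (hvac : vac ∈ 𝒱 0)
    (T : Module.End ℂ V) (hT : ∀ p, ∀ v ∈ 𝒱 p, T v ∈ 𝒱 p)
    (S : Fin N → Module.End ℂ V) (hS : ∀ i p, ∀ v ∈ 𝒱 p, S i v ∈ 𝒱 (p + 1))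
    (hSS : ∀ i j, i ≠ j → S i * S j = -(S j * S i))
    (hTS : ∀ i, T * S i = S i * T)
    (hTvac : T vac = 0) (hSvac : ∀ i, S i vac = 0)
    {A : Type*} (par : A → ZMod 2) (a : A → SuperField N V)
    (hpar : ∀ α, HasParity 𝒱 (par α) (a α).1)
    (x : A → V)
    (hreg : ∀ α, ∀ n < 0, ∀ I, (a α).1 n I vac = 0)
    (hconst : ∀ α, (a α).1 0 ∅ vac = x α)
    (hTa : ∀ α, opBracket 0 (par α) T (a α).1 = dz (a α).1)
    (hSa : ∀ α i, opBracket 1 (par α) (S i) (a α).1 = dtheta i (a α).1)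
    (hloc : ∀ α β, IsLocal (par α) (par β) (a α).1 (a β).1)
    (hspan : Submodule.span ℂ (Set.range (wordVec a vac)) = ⊤) :
    ∃ B : SUSYVertexAlgebra N 𝒱,
      (B.vac = vac ∧ B.T = T ∧ B.S = S ∧
        (∀ w : List (A × ℤ × Finset (Fin N)),
          B.Y (wordVec a vac w) = wordSign w • wordField par a w) ∧
        ∀ α, B.Y (x α) = a α) ∧
      ∀ C : SUSYVertexAlgebra N 𝒱, C.vac = vac → C.T = T → C.S = S →
        (∀ α, C.Y (x α) = a α) → C = B := by
  have ha : ∀ α, IsStateField 𝒱 vac T S par a (par α) (a α) := fun α =>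
    ⟨hpar α, hreg α, hTa α, hSa α, fun β => hloc β α⟩
  have hx : ∀ α, x α ∈ 𝒱 (par α) := fun α => by
    rw [← hconst]
    exact stateMap_mem hvac (hpar α)
  obtain ⟨Y, hY, hYmem⟩ := exists_stateField hvac hTvac hSvac ha hspan
  have hYF : ∀ p, ∀ v ∈ 𝒱 p, IsStateField 𝒱 vac T S par a p (Y v) := fun p v hv =>
    isStateField_of_mem_wordFieldSpan ha (hYmem p v hv)
  have huniq : ∀ p, ∀ v ∈ 𝒱 p, ∀ f, IsStateField 𝒱 vac T S par a p f →
      f.1 0 ∅ vac = v → f = Y v := fun p v hv f hf hfv =>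
    hf.eq_of_vac_eq (hYF p v hv) hTvac hSvac hspan (hfv.trans (hY v).symm)
  refine ⟨
    { vac := vac
      T := T
      S := S
      Y := Y
      vac_even := hvac
      T_even := hT
      S_odd := hS
      Y_parity := fun p v hv => (hYF p v hv).hasParity
      Y_vac_regular := fun v => by
        induction v using DirectSum.Decomposition.inductionOn 𝒱 with
        | zero => simp
        | @homogeneous p v => exact (hYF p v v.2).regular
        | add v w hv hw =>
          intro n hn I
          rw [map_add, Submodule.coe_add, Pi.add_apply, Pi.add_apply, LinearMap.add_apply,
            hv n hn, hw n hn, add_zero]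
      Y_vac_const := hY
      T_vac := hTvac
      S_vac := hSvac
      T_bracket := fun p v hv => (hYF p v hv).T_bracket
      S_bracket := fun i p v hv => (hYF p v hv).S_bracket i
      locality := fun p q v hv w hw =>
        isLocal_of_mem_wordFieldSpan ha (hYmem p v hv) (hYmem q w hw) },
    ⟨rfl, rfl, rfl, fun w => ?_, fun α => ?_⟩, fun C hCvac hCT hCS hCY => ?_⟩
  · refine (huniq _ _ (wordVec_mem hvac ha w) _ (mem_stateFields.1
      (Submodule.smul_mem _ _ (mem_stateFields.2 (isStateField_wordField ha w)))) ?_).symm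
    rw [Submodule.coe_smul, Pi.smul_apply, Pi.smul_apply, LinearMap.smul_apply, wordField_vac ha,
      smul_smul, wordSign_mul_self, one_smul]
  · exact (huniq _ _ (hx α) _ (ha α) (hconst α)).symm
  · refine SUSYVertexAlgebra.ext hCvac hCT hCS ?_
    ext1 v
    induction v using DirectSum.Decomposition.inductionOn 𝒱 with
    | zero => simp
    | @homogeneous p v =>
      -- Any competing `C.Y v` is local to the generators because they are themselves values of
      -- `C.Y`, so Goddard uniqueness identifies it with `Y v`.
      refine huniq p v v.2 _ ⟨C.Y_parity p v v.2, hCvac ▸ C.Y_vac_regular v,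
        hCT ▸ C.T_bracket p v v.2, fun i => hCS ▸ C.S_bracket i p v v.2, fun α => ?_⟩
        (hCvac ▸ C.Y_vac_const v)
      rw [← hCY α]
      exact C.locality _ _ _ (hx α) _ v.2
    | add v w hv hw => rw [map_add, map_add, hv, hw]
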